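/- Let $\mathbb K$ be an algebraically closed field of characteristic $0$, let $V=\mathbb K^{N+1}$, and let $B\subset\mathbb G(k,N)$ be an irreducible closed subvariety of dimension $n$ of the Grassmannian of $k$-dimensional linear subspaces of $\mathbb P^N=\mathbb P(V)$. Suppose that the union of the $k$-spaces belonging to $B$ is an (irreducible, closed) algebraic variety $X\subset\mathbb P^N$ of dimension $n+k<N$. For a nonsingular point $\Lambda=\mathbb P(\hat\Lambda)$ of $B$, regard $T_\Lambda B$ as a subspace of $T_\Lambda\mathbb G(k,N)=\operatorname{Hom}(\hat\Lambda,V/\hat\Lambda)$. The characteristic map of $B$ relative to $\Lambda$ is the map $\chi(\Lambda):T_\Lambda B\otimes\mathcal O_\Lambda\to\mathcal N_{\Lambda|\mathbb P^N}$ given at $[v]\in\Lambda$ by $\eta\mapsto\eta(v)\in V/\hat\Lambda$. A point of $\Lambda$ is focal if $\chi(\Lambda)$ does not have maximal rank there; the focal subscheme of $\Lambda$ is the closed subscheme defined by the minors of maximal order of the matrix of linear forms that represents $\chi(\Lambda)$. Then the following are equivalent: (i) the tangent space to $X$ is constant along general elements of $B$, that is, there is a nonempty open subset of $B$ such that every $\Lambda$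 in it contains nonsingular points of $X$, and the embedded tangent space $\mathbb T_xX$ is the same for all nonsingular points $x$ of $X$ lying on $\Lambda$; (ii) there is an open subset $U$ of $B$, containing nonsingular points of $B$, such that for every nonsingular point $\Lambda$ of $B$: if $\Lambda\in U$, then the focal subscheme of $\Lambda$ is a hypersurface of degree $n$ of $\Lambda$; if $\Lambda\notin U$, then all points of $\Lambda$ are focal. (Here a hypersurface of degree $d$ of $\Lambda\cong\mathbb P^k$ is the closed subscheme defined by a nonzero form of degree $d$ in $k+1$ variables; it is empty if $d=0$ or $k=0$.) -/

import Mathlib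

open scoped LinearAlgebra.Projectivization

noncomputable section

namespace RuledVariety

section Affine

variable {K : Type*} [Field K] {σ : Type*}

/-- The Zariski topology on the affine space `K^σ`: the closed sets are the common zero sets of
families of polynomials. -/
abbrev zariskiTopology (K : Type*) [Field K] (σ : Type*) : TopologicalSpace (σ → K) :=
  TopologicalSpace.induced
    (MvPolynomial.pointToPoint : (σ → K) → PrimeSpectrum (MvPolynomial σ K)) inferInstance

theorem isClosed_zariski_iff (Z : Set (σ → K)) :
    @IsClosed _ (zariskiTopology K σ) Z ↔
      ∃ S : Set (MvPolynomial σ K), Z = {x | ∀ P ∈ S, MvPolynomial.eval x P = 0} := by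
  have key : ∀ S : Set (MvPolynomial σ K),
      (MvPolynomial.pointToPoint : (σ → K) → PrimeSpectrum (MvPolynomial σ K)) ⁻¹'
        PrimeSpectrum.zeroLocus S = {x | ∀ P ∈ S, MvPolynomial.eval x P = 0} := by
    intro S
    ext x
    simp [MvPolynomial.pointToPoint, PrimeSpectrum.mem_zeroLocus, Set.subset_def,
      MvPolynomial.aeval_eq_eval]
  rw [isClosed_induced_iff]
  constructor
  · rintro ⟨t, ht, rfl⟩
    obtain ⟨S, rfl⟩ := (PrimeSpectrum.isClosed_iff_zeroLocus t).1 ht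
    exact ⟨S, key S⟩
  · rintro ⟨S, rfl⟩
    exact ⟨_, PrimeSpectrum.isClosed_zeroLocus S, key S⟩

/-- The Zariski tangent space at `x` of the (reduced) closure of `C ⊆ K^σ`: the vectors `w` killed
by the differentials at `x` of all polynomials vanishing on `C`. -/
def tangentSpace [Fintype σ] (C : Set (σ → K)) (x : σ → K) : Submodule K (σ → K) where
  carrier := {w | ∀ P : MvPolynomial σ K, (∀ y ∈ C, MvPolynomial.eval y P = 0) →
    ∑ i, MvPolynomial.eval x (MvPolynomial.pderiv i P) * w i = 0}
  add_mem' := by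
    intro a b ha hb P hP
    simp [mul_add, Finset.sum_add_distrib, ha P hP, hb P hP]
  zero_mem' := by
    intro P _
    simp
  smul_mem' := by
    intro c a ha P hP
    have h : ∀ i, MvPolynomial.eval x (MvPolynomial.pderiv i P) * (c • a) i
        = c * (MvPolynomial.eval x (MvPolynomial.pderiv i P) * a i) := by
      intro i
      simp only [Pi.smul_apply, smul_eq_mul]
      ring
    simp only [h, ← Finset.mul_sum, ha P hP, mul_zero]

end Affine

/-- The underlying vector space `V` of `ℙ^N`. -/
abbrev Vec (K : Type*) (N : ℕ) : Type _ := Fin (N + 1) → K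

/-- The projective space `ℙ^N` over `K`. -/
abbrev PSpace (K : Type*) [Field K] (N : ℕ) : Type _ := ℙ K (Vec K N)

/-- The Grassmannian `𝔾(k, N) = G(k + 1, V)` of projective `k`-spaces in `ℙ^N`. -/
def Gr (K : Type*) [Field K] (N k : ℕ) : Type _ :=
  {L : Submodule K (Vec K N) // Module.finrank K L = k + 1}

variable {K : Type*} [Field K] {N k : ℕ}

/-- The linear subspace `Λ̂ ⊆ V` with `Λ = ℙ(Λ̂)`. -/
def Gr.toSub (L : Gr K N k) : Submodule K (Vec K N) := L.1

/-! ### Projective varieties -/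

/-- The Zariski topology of `ℙ^N`, as the quotient of `V ∖ {0}`. -/
instance : TopologicalSpace (PSpace K N) :=
  TopologicalSpace.coinduced (Projectivization.mk' K)
    (TopologicalSpace.induced (Subtype.val : {v : Vec K N // v ≠ 0} → Vec K N)
      (zariskiTopology K (Fin (N + 1))))

/-- The affine cone (without the origin) over `X ⊆ ℙ^N`. -/
def cone (X : Set (PSpace K N)) : Set (Vec K N) :=
  {v | ∃ h : v ≠ 0, Projectivization.mk K v h ∈ X}

/-- The embedded tangent space `𝕋_x X ⊆ ℙ^N`, given as a linear subspace of `V`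
(so its projective dimension is `finrank - 1`). -/
def embeddedTangentSpace (X : Set (PSpace K N)) (x : PSpace K N) : Submodule K (Vec K N) :=
  tangentSpace (cone X) x.rep

/-- `x` is a nonsingular point of the irreducible projective variety `X`:
`dim 𝕋_x X = dim X` as projective spaces. -/
def IsSmoothPoint (X : Set (PSpace K N)) (x : PSpace K N) : Prop :=
  x ∈ X ∧ ((Module.finrank K (embeddedTangentSpace X x) : ℕ) : WithBot ℕ∞)
    = topologicalKrullDim X + 1

/-! ### Subvarieties of the Grassmannian -/

/-- The frames of the members of `B ⊆ 𝔾(k, N)`: the matrices whose `k + 1` rows form a basis of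
`Λ̂` for some `Λ ∈ B`. -/
def frames (B : Set (Gr K N k)) : Set (Fin (k + 1) × Fin (N + 1) → K) :=
  {M | ∃ L ∈ B, ∃ b : Module.Basis (Fin (k + 1)) K L.toSub, ∀ i j, M (i, j) = (b i : Vec K N) j}

/-- The `k`-space spanned by the rows of a matrix of rank `k + 1`. -/
def spanGr (M : {M : Fin (k + 1) × Fin (N + 1) → K //
    LinearIndependent K (fun i j => M (i, j) : Fin (k + 1) → Vec K N)}) : Gr K N k :=
  ⟨Submodule.span K (Set.range (fun i j => M.1 (i, j) : Fin (k + 1) → Vec K N)), by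
    rw [finrank_span_eq_card M.2, Fintype.card_fin]⟩

/-- The Zariski topology of the Grassmannian, as the quotient by `GL_{k+1}` of the open set of
matrices of rank `k + 1` in the affine space of `(k + 1) × (N + 1)` matrices. For `k = 0` this is
the topology of `ℙ^N` above. -/
instance : TopologicalSpace (Gr K N k) :=
  TopologicalSpace.coinduced spanGr
    (TopologicalSpace.induced Subtype.val (zariskiTopology K (Fin (k + 1) × Fin (N + 1))))

/-- The tangent space `T_Λ B`, as a subspace of `T_Λ 𝔾(k, N) = Hom(Λ̂, V / Λ̂)`. The differential
at a frame `b` of `Λ` of the quotient map from frames to the Grassmannian sends a matrix `M'` to the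
homomorphism `b i ↦ (i-th row of M') mod Λ̂`; `T_Λ B` is the image under it of the tangent space at
`b` to the set of frames of members of `B` (it does not depend on `b`). -/
def tangentSpaceGr (B : Set (Gr K N k)) (L : Gr K N k) :
    Submodule K (L.toSub →ₗ[K] (Vec K N ⧸ L.toSub)) where
  carrier := {η | ∀ b : Module.Basis (Fin (k + 1)) K L.toSub,
    ∃ M' ∈ tangentSpace (frames B) (fun p => (b p.1 : Vec K N) p.2),
      ∀ i, η (b i) = Submodule.Quotient.mk (fun j => M' (i, j))}
  add_mem' := by
    intro η θ hη hθ b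
    obtain ⟨M, hM, h⟩ := hη b
    obtain ⟨M', hM', h'⟩ := hθ b
    refine ⟨M + M', Submodule.add_mem _ hM hM', fun i => ?_⟩
    rw [LinearMap.add_apply, h, h', ← Submodule.Quotient.mk_add]
    rfl
  zero_mem' := by
    intro b
    refine ⟨0, Submodule.zero_mem _, fun i => ?_⟩
    rw [LinearMap.zero_apply]
    exact (Submodule.Quotient.mk_zero _).symm
  smul_mem' := by
    intro c η hη b
    obtain ⟨M, hM, h⟩ := hη b
    refine ⟨c • M, Submodule.smul_mem _ c hM, fun i => ?_⟩
    rw [LinearMap.smul_apply, h, ← Submodule.Quotient.mk_smul]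
    rfl

/-- `Λ` is a nonsingular point of the irreducible variety `B ⊆ 𝔾(k, N)`:
`dim T_Λ B = dim B`. -/
def IsSmoothMember (B : Set (Gr K N k)) (L : Gr K N k) : Prop :=
  L ∈ B ∧ ((Module.finrank K (tangentSpaceGr B L) : ℕ) : WithBot ℕ∞) = topologicalKrullDim B

/-- The union `X ⊆ ℙ^N` of the `k`-spaces of the family `B`. -/
def unionOf (B : Set (Gr K N k)) : Set (PSpace K N) :=
  {x | ∃ L ∈ B, x.submodule ≤ L.toSub}

/-! ### Focal points -/

/-- The fibre at `v ∈ Λ̂` of the characteristic map of `B` relative to `Λ`. Here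
`T_Λ B → N_{Λ̂ | V, v} = V / Λ̂` sends a tangent vector `η ∈ Hom(Λ̂, V / Λ̂)` to `η v`. -/
def characteristicMap (B : Set (Gr K N k)) (L : Gr K N k) (v : L.toSub) :
    tangentSpaceGr B L →ₗ[K] (Vec K N ⧸ L.toSub) :=
  (LinearMap.applyₗ v).comp (tangentSpaceGr B L).subtype

/-- The maximal possible rank of the characteristic map relative to `Λ`. -/
def maxRank (B : Set (Gr K N k)) (L : Gr K N k) : ℕ :=
  min (Module.finrank K (tangentSpaceGr B L)) (Module.finrank K (Vec K N ⧸ L.toSub))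

/-- `[v] ∈ Λ` is a focal point: the characteristic map relative to `Λ` does not have maximal rank
at `v`. -/
def IsFocalAt (B : Set (Gr K N k)) (L : Gr K N k) (v : L.toSub) : Prop :=
  Module.finrank K (LinearMap.range (characteristicMap B L v)) < maxRank B L

/-- All points of `Λ` are focal. -/
def AllFocal (B : Set (Gr K N k)) (L : Gr K N k) : Prop :=
  ∀ v : L.toSub, v ≠ 0 → IsFocalAt B L v

/-- The entry, with respect to a tangent vector `η` and a functional `φ` on `V / Λ̂`, of the matrix
of the characteristic map: the linear form `v ↦ φ (η v)` on `Λ̂`, written in the homogeneous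
coordinates of `Λ` given by a basis `b` of `Λ̂`. -/
def charEntry (L : Gr K N k) (b : Module.Basis (Fin (k + 1)) K L.toSub)
    (η : L.toSub →ₗ[K] (Vec K N ⧸ L.toSub)) (φ : Module.Dual K (Vec K N ⧸ L.toSub)) :
    MvPolynomial (Fin (k + 1)) K :=
  ∑ l, MvPolynomial.C (φ (η (b l))) * MvPolynomial.X l

/-- The homogeneous ideal of the focal subscheme of `Λ`, in the coordinates given by `b`: it is
generated by the minors of maximal order of the matrix of the characteristic map. -/
def focalIdeal (B : Set (Gr K N k)) (L : Gr K N k) (b : Module.Basis (Fin (k + 1)) K L.toSub) :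
    Ideal (MvPolynomial (Fin (k + 1)) K) :=
  Ideal.span {P | ∃ (η : Fin (maxRank B L) → tangentSpaceGr B L)
    (φ : Fin (maxRank B L) → Module.Dual K (Vec K N ⧸ L.toSub)),
    P = (Matrix.of fun i j => charEntry L b (η i).1 (φ j)).det}

/-- Two homogeneous ideals of `K[x_0, …, x_k]` define the same closed subscheme of `ℙ^k`, i.e. their
saturations with respect to the irrelevant ideal `(x_0, …, x_k)` agree. -/
def SameSubscheme (I J : Ideal (MvPolynomial (Fin (k + 1)) K)) : Prop :=
  ∀ P, (∃ m : ℕ, ∀ Q ∈ Ideal.span (Set.range (MvPolynomial.X (R := K) (σ := Fin (k + 1)))) ^ m,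
      Q * P ∈ I) ↔
    (∃ m : ℕ, ∀ Q ∈ Ideal.span (Set.range (MvPolynomial.X (R := K) (σ := Fin (k + 1)))) ^ m,
      Q * P ∈ J)

/-- The focal subscheme of `Λ` is a hypersurface of degree `d` of `Λ`. -/
def FocalHypersurface (B : Set (Gr K N k)) (L : Gr K N k) (d : ℕ) : Prop :=
  ∀ b : Module.Basis (Fin (k + 1)) K L.toSub, ∃ F : MvPolynomial (Fin (k + 1)) K,
    F ≠ 0 ∧ F.IsHomogeneous d ∧ SameSubscheme (focalIdeal B L b) (Ideal.span {F})

/-! ### The two properties -/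

/-- The tangent space to `X` is constant along `Λ`: `Λ` contains nonsingular points of `X`, and `X`
has the same embedded tangent space at all of them. -/
def TangentConstantAlong (X : Set (PSpace K N)) (L : Gr K N k) : Prop :=
  (∃ x : PSpace K N, x.submodule ≤ L.toSub ∧ IsSmoothPoint X x) ∧
  ∃ T : Submodule K (Vec K N), ∀ x : PSpace K N, x.submodule ≤ L.toSub → IsSmoothPoint X x →
    embeddedTangentSpace X x = T

end RuledVariety

end

/-!
The image of `χ(Λ)` at `v`, pulled back to `V`, is a linear space `tangentHull B Λ v` containing
`Λ̂`. It is spanned by the velocities at `v` of the deformations of `Λ` in `B`, so it is contained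
in the tangent space to the cone over `X` at `v`, whose dimension is `n + k + 1` at nonsingular
points of `X`. By generic smoothness, a general point of a general `Λ` is not focal, and then the
hull has dimension `n + k + 1` too.

Hence the tangent space is constant along `Λ` if and only if the image of `χ(Λ)` at `v` lies in a
fixed `n`-dimensional subspace of `V / Λ̂`. In that case the `n × n` minors of the matrix of `χ(Λ)`
are the constant multiples of a single one, which is a form of degree `n`. Conversely, if these
minors are multiples of one form, then Cramer's rule expresses the matrix through `n` of its
columns with constant coefficients, so that the images lie in a fixed space. From general `Λ` the
constancy of the image passes to all `Λ` that are not totally focal: an image that moves would give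
`n + k + 2` independent vectors in the tangent space along a nearby general member.
-/

noncomputable section

namespace RuledVariety

open MvPolynomial Matrix

/-! ### Tangent spaces and generic points -/

section LinearAlgebra

variable {F : Type*} [Field F] {σ ι : Type*} [Fintype σ]

/-- The orthogonal complement of a set of vectors for the dot product. -/
def perp (S : Set (σ → F)) : Submodule F (σ → F) where
  carrier := {w | ∀ a ∈ S, a ⬝ᵥ w = 0}
  add_mem' := by
    intro v w hv hw a ha
    rw [dotProduct_add, hv a ha, hw a ha, add_zero]
  zero_mem' := fun a _ => dotProduct_zero a
  smul_mem' := by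
    intro c w hw a ha
    rw [dotProduct_smul, hw a ha, smul_zero]

theorem mem_perp {S : Set (σ → F)} {w : σ → F} : w ∈ perp S ↔ ∀ a ∈ S, a ⬝ᵥ w = 0 := Iff.rfl

theorem perp_anti {S T : Set (σ → F)} (h : S ⊆ T) : perp T ≤ perp S :=
  fun _ hw a ha => hw a (h ha)

theorem perp_span (S : Set (σ → F)) : perp (Submodule.span F S : Set (σ → F)) = perp S := by
  refine le_antisymm (perp_anti Submodule.subset_span) fun w hw a ha => ?_
  induction ha using Submodule.span_induction with
  | mem a ha => exact hw a ha
  | zero => exact zero_dotProduct w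
  | add a b _ _ ha hb => rw [add_dotProduct, ha, hb, add_zero]
  | smul c a _ ha => rw [smul_dotProduct, ha, smul_zero]

theorem perp_range_row (J : Matrix ι σ F) :
    perp (Set.range J.row) = LinearMap.ker J.mulVecLin := by
  ext w
  simp only [mem_perp, Set.forall_mem_range, LinearMap.mem_ker, mulVecLin_apply, funext_iff]
  rfl

theorem card_add_finrank_perp_range_row [Fintype ι] {J : Matrix ι σ F}
    (hJ : LinearIndependent F J.row) :
    Fintype.card ι + Module.finrank F (perp (Set.range J.row)) = Fintype.card σ := by
  rw [perp_range_row, ← LinearIndependent.rank_matrix hJ, rank,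
    LinearMap.finrank_range_add_finrank_ker, Module.finrank_fintype_fun_eq_card]

theorem exists_linearIndependent_perp_range_eq (S : Set (σ → F)) :
    ∃ (r : ℕ) (f : Fin r → σ → F), (∀ i, f i ∈ S) ∧ LinearIndependent F f ∧
      perp (Set.range f) = perp S := by
  obtain ⟨f, hfS, hspan, hf⟩ := Submodule.exists_fun_fin_finrank_span_eq F S
  exact ⟨_, f, hfS, hf, by rw [← perp_span (Set.range f), hspan, perp_span]⟩

theorem exists_mul_eq_one_of_linearIndependent_row [Finite ι] [DecidableEq ι]
    {J : Matrix ι σ F} (hJ : LinearIndependent F J.row) : ∃ R : Matrix σ ι F, J * R = 1 := by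
  classical
  have := Fintype.ofFinite ι
  have hrange : LinearMap.range J.mulVecLin = ⊤ := Submodule.eq_top_of_finrank_eq <| by
    rw [Module.finrank_fintype_fun_eq_card, ← LinearIndependent.rank_matrix hJ, rank]
  exact mulVec_surjective_iff_exists_right_inverse.1 (LinearMap.range_eq_top.1 hrange)

theorem linearIndependent_row_of_det_mul_ne_zero [Fintype ι] [DecidableEq ι]
    {J : Matrix ι σ F} {R : Matrix σ ι F} (h : (J * R).det ≠ 0) : LinearIndependent F J.row := by
  rw [← vecMul_injective_iff]
  refine Function.Injective.of_comp (f := fun v => v ᵥ* R) ?_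
  have hJR := vecMul_injective_of_isUnit ((isUnit_iff_isUnit_det _).2 h.isUnit)
  simpa only [Function.comp_def, vecMul_vecMul] using hJR

end LinearAlgebra

section Differential

variable {K L : Type*} [Field K] [Field L] [Algebra K L] {σ τ : Type*}

/-- The gradient of a polynomial over `K` at an `L`-valued point `x`. Points over extensions of `K`
are needed to speak of generic points. -/
def grad (x : σ → L) (P : MvPolynomial σ K) : σ → L :=
  fun i => aeval x (pderiv i P)

theorem derivation_aeval {R A M : Type*} [CommRing R] [CommRing A] [Algebra R A]
    [AddCommGroup M] [Module A M] [Module R M] [Fintype σ] (D : Derivation R A M) (a : σ → A)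
    (P : MvPolynomial σ R) : D (aeval a P) = ∑ i, aeval a (pderiv i P) • D (a i) := by
  classical
  induction P using MvPolynomial.induction_on with
  | C c => simp
  | add P Q hP hQ => simp only [map_add, hP, hQ, add_smul, Finset.sum_add_distrib]
  | mul_X P j hP =>
    simp only [map_mul, aeval_X, Derivation.leibniz, hP, pderiv_X, smul_eq_mul, map_add, add_smul,
      Finset.sum_add_distrib, mul_smul, Finset.smul_sum, Pi.single_apply, smul_ite, ite_smul,
      apply_ite (aeval a), map_one, map_zero, one_smul, zero_smul, smul_zero]
    simp

variable [Fintype σ]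

/-- The tangent space at an `L`-valued point of the scheme cut out by a set of polynomials. -/
def tangentAt (I : Set (MvPolynomial σ K)) (x : σ → L) : Submodule L (σ → L) :=
  perp (grad x '' I)

theorem mem_tangentAt {I : Set (MvPolynomial σ K)} {x w : σ → L} :
    w ∈ tangentAt I x ↔ ∀ P ∈ I, grad x P ⬝ᵥ w = 0 := by
  simp only [tangentAt, mem_perp, Set.forall_mem_image]

theorem tangentSpace_eq_tangentAt (C : Set (σ → K)) (x : σ → K) :
    tangentSpace C x = tangentAt (vanishingIdeal K C : Set (MvPolynomial σ K)) x := by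
  ext w
  rw [mem_tangentAt]
  rfl

theorem mem_tangentSpace {C : Set (σ → K)} {x w : σ → K} :
    w ∈ tangentSpace C x ↔ ∀ P ∈ vanishingIdeal K C, grad x P ⬝ᵥ w = 0 := Iff.rfl

/-- The differential at `x` of the polynomial map with components `φ`. -/
def diffMap (φ : τ → MvPolynomial σ K) (x : σ → L) : (σ → L) →ₗ[L] (τ → L) where
  toFun w := fun j => grad x (φ j) ⬝ᵥ w
  map_add' _ _ := funext fun _ => dotProduct_add _ _ _
  map_smul' _ _ := funext fun _ => dotProduct_smul _ _ _

theorem diffMap_apply (φ : τ → MvPolynomial σ K) (x w : σ → L) (j : τ) :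
    diffMap φ x w j = grad x (φ j) ⬝ᵥ w := rfl

theorem grad_bind₁ [Fintype τ] (φ : τ → MvPolynomial σ K) (x w : σ → L) (Q : MvPolynomial τ K) :
    grad x (bind₁ φ Q) ⬝ᵥ w = grad (fun j => aeval x (φ j)) Q ⬝ᵥ diffMap φ x w := by
  have hpderiv : ∀ i, aeval x (pderiv i (bind₁ φ Q)) =
      ∑ j, aeval (fun j => aeval x (φ j)) (pderiv j Q) * aeval x (pderiv i (φ j)) := by
    intro i
    rw [bind₁, derivation_aeval, map_sum]
    refine Finset.sum_congr rfl fun j _ => ?_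
    rw [smul_eq_mul, map_mul]
    exact congrArg (· * _) (aeval_bind₁ x φ _)
  simp only [dotProduct, grad, diffMap_apply, hpderiv, Finset.sum_mul, Finset.mul_sum]
  rw [Finset.sum_comm]
  simp only [mul_assoc]

theorem diffMap_mem_tangentSpace [Fintype τ] {C : Set (σ → K)} {D : Set (τ → K)}
    (φ : τ → MvPolynomial σ K) (hφ : ∀ x ∈ C, (fun j => eval x (φ j)) ∈ D) {x w : σ → K}
    (hw : w ∈ tangentSpace C x) :
    diffMap φ x w ∈ tangentSpace D (fun j => eval x (φ j)) := by
  rw [mem_tangentSpace] at hw ⊢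
  intro Q hQ
  refine (grad_bind₁ φ x w Q).symm.trans (hw _ fun y hy => ?_)
  rw [aeval_bind₁]
  exact hQ _ (hφ y hy)

theorem grad_dotProduct_congr [Infinite K] {P Q : MvPolynomial σ K} {x w : σ → K}
    (h : ∀ t : K, eval (x + t • w) P = eval (x + t • w) Q) :
    grad x P ⬝ᵥ w = grad x Q ⬝ᵥ w := by
  let line : σ → MvPolynomial Unit K := fun i => C (x i) + C (w i) * X ()
  have hline : ∀ s : Unit → K, (fun j => aeval s (line j)) = x + s () • w := by
    intro s
    funext j
    simp [line, mul_comm]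
  have hPQ : bind₁ line P = bind₁ line Q := by
    refine MvPolynomial.funext fun s => ?_
    simp only [← aeval_eq_eval, aeval_bind₁, hline]
    exact h (s ())
  have hd : diffMap line (0 : Unit → K) (fun _ => 1) = w := by
    funext j
    simp [diffMap_apply, grad, line, dotProduct]
  have hP := grad_bind₁ line (0 : Unit → K) (fun _ => 1) P
  have hQ := grad_bind₁ line (0 : Unit → K) (fun _ => 1) Q
  rw [hd, hline, Pi.zero_apply, zero_smul, add_zero] at hP hQ
  rw [← hP, ← hQ, hPQ]

end Differential

section LocalExtension

variable {K σ : Type*} [Field K] [Fintype σ]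

/-- A kernel vector `w` of `J(x₀)` is corrected to `det (J R) w - R adj (J R) J w`, where `R` is a
constant right inverse of `J(x₀)`. -/
theorem exists_polynomial_kernel_extension {ι : Type*} [Finite ι]
    (J : Matrix ι σ (MvPolynomial σ K)) {x₀ : σ → K}
    (hJ : LinearIndependent K (J.map (eval x₀)).row) :
    ∃ D : MvPolynomial σ K, eval x₀ D ≠ 0 ∧
      (∀ x, eval x D ≠ 0 → LinearIndependent K (J.map (eval x)).row) ∧
      ∀ w, J.map (eval x₀) *ᵥ w = 0 → ∃ W : σ → MvPolynomial σ K,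
        eval x₀ ∘ W = w ∧ J *ᵥ W = 0 := by
  classical
  have := Fintype.ofFinite ι
  obtain ⟨R, hR⟩ := exists_mul_eq_one_of_linearIndependent_row hJ
  let R' : Matrix σ ι (MvPolynomial σ K) := R.map C
  have hdet : ∀ x, eval x (J * R').det = (J.map (eval x) * R).det := by
    intro x
    have hR' : R'.map (eval x) = R := by
      ext i j
      simp [R']
    rw [RingHom.map_det, RingHom.mapMatrix_apply, Matrix.map_mul, hR']
  have hdet₀ : eval x₀ (J * R').det = 1 := by rw [hdet, hR, det_one]
  refine ⟨(J * R').det, by rw [hdet₀]; exact one_ne_zero, fun x hx =>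
    linearIndependent_row_of_det_mul_ne_zero (hdet x ▸ hx), fun w hw => ?_⟩
  refine ⟨(J * R').det • (C ∘ w) - R' *ᵥ ((J * R').adjugate *ᵥ (J *ᵥ (C ∘ w))), ?_, ?_⟩
  · have hJw : eval x₀ ∘ (J *ᵥ (C ∘ w)) = 0 := by
      funext i
      rw [Function.comp_apply, RingHom.map_mulVec, ← Function.comp_assoc]
      exact (congrArg (fun u => (J.map (eval x₀) *ᵥ u) i) (by ext; simp)).trans (congrFun hw i)
    funext i
    rw [Function.comp_apply, mulVec_mulVec, Pi.sub_apply, map_sub, RingHom.map_mulVec, hJw,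
      mulVec_zero, Pi.zero_apply, sub_zero, Pi.smul_apply, smul_eq_mul, map_mul, hdet₀, one_mul,
      Function.comp_apply, eval_C]
  · rw [mulVec_sub, mulVec_smul, mulVec_mulVec, mulVec_mulVec, mul_adjugate, smul_mulVec,
      one_mulVec, sub_self]

theorem tangentSpace_le_perp_range_grad {C : Set (σ → K)} {ι : Type*} {P : ι → MvPolynomial σ K}
    (hP : ∀ i, P i ∈ vanishingIdeal K C) (x : σ → K) :
    tangentSpace C x ≤ perp (Set.range fun i => grad x (P i)) := by
  rw [tangentSpace_eq_tangentAt]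
  refine perp_anti ?_
  rintro _ ⟨i, rfl⟩
  exact ⟨P i, hP i, rfl⟩

theorem exists_local_extension (C : Set (σ → K)) (x₀ : σ → K) :
    ∃ D : MvPolynomial σ K, eval x₀ D ≠ 0 ∧
      (∀ x, eval x D ≠ 0 →
        Module.finrank K (tangentSpace C x) ≤ Module.finrank K (tangentSpace C x₀)) ∧
      ∀ w ∈ tangentSpace C x₀, ∃ W : σ → MvPolynomial σ K, eval x₀ ∘ W = w ∧
        ∀ x, eval x D ≠ 0 →
          Module.finrank K (tangentSpace C x₀) ≤ Module.finrank K (tangentSpace C x) →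
          eval x ∘ W ∈ tangentSpace C x := by
  obtain ⟨r, f, hfS, hf, hperp⟩ := exists_linearIndependent_perp_range_eq
    (grad x₀ '' (vanishingIdeal K C : Set (MvPolynomial σ K)))
  choose P hP hPf using hfS
  obtain rfl : (fun i => grad x₀ (P i)) = f := funext hPf
  let J : Matrix (Fin r) σ (MvPolynomial σ K) := Matrix.of fun i j => pderiv j (P i)
  obtain ⟨D, hD₀, hD, hW⟩ := exists_polynomial_kernel_extension J (x₀ := x₀) hf
  have hle : ∀ x, tangentSpace C x ≤ perp (Set.range (J.map (eval x)).row) :=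
    tangentSpace_le_perp_range_grad hP
  have heq₀ : tangentSpace C x₀ = perp (Set.range (J.map (eval x₀)).row) := by
    rw [tangentSpace_eq_tangentAt]
    exact hperp.symm
  have hrank : ∀ x, eval x D ≠ 0 → Module.finrank K (perp (Set.range (J.map (eval x)).row)) =
      Module.finrank K (tangentSpace C x₀) := by
    intro x hx
    have hx' := card_add_finrank_perp_range_row (hD x hx)
    have hx₀' := card_add_finrank_perp_range_row (hD x₀ hD₀)
    rw [heq₀]
    omega
  refine ⟨D, hD₀, fun x hx => (Submodule.finrank_mono (hle x)).trans_eq (hrank x hx),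
    fun w hw => ?_⟩
  rw [heq₀, perp_range_row] at hw
  obtain ⟨W, hWw, hJW⟩ := hW w hw
  refine ⟨W, hWw, fun x hx hge => ?_⟩
  rw [Submodule.eq_of_le_of_finrank_le (hle x) ((hrank x hx).trans_le hge), perp_range_row]
  funext i
  have := congrArg (eval x) (congrFun hJW i)
  rwa [RingHom.map_mulVec, Pi.zero_apply, map_zero] at this

end LocalExtension

section Derivation

open TensorProduct

theorem exists_derivation_compAlgebraMap_eq {R A B M : Type*} [CommRing R] [CommRing A]
    [CommRing B] [Algebra R A] [Algebra R B] [Algebra A B] [IsScalarTower R A B]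
    [Algebra.FormallySmooth A B] [AddCommGroup M] [Module R M] [Module A M] [Module B M]
    [IsScalarTower R A M] [IsScalarTower R B M] [IsScalarTower A B M] (d : Derivation R A M) :
    ∃ D : Derivation R B M, D.compAlgebraMap A = d := by
  -- Formal smoothness splits `0 → B ⊗[A] Ω[A⁄R] → Ω[B⁄R] → Ω[B⁄A] → 0`.
  have hinj : Function.Injective (KaehlerDifferential.mapBaseChange R A B) := by
    rw [injective_iff_map_eq_zero]
    intro x hx
    obtain ⟨y, rfl⟩ := (Algebra.H1Cotangent.exact_δ_mapBaseChange R A B x).1 hx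
    rw [Subsingleton.elim y 0, map_zero]
  obtain ⟨s, hs⟩ := Module.projective_lifting_property (KaehlerDifferential.map R A B B)
    LinearMap.id (KaehlerDifferential.map_surjective R A B)
  have hsplit := (KaehlerDifferential.exact_mapBaseChange_map R A B).split_tfae'.out 0 1
  obtain ⟨-, r, hr⟩ := hsplit.1 ⟨hinj, s, hs⟩
  let f : B ⊗[A] Ω[A⁄R] →ₗ[B] M :=
    (TensorProduct.isBaseChange A Ω[A⁄R] B).lift d.liftKaehlerDifferential
  refine ⟨(f ∘ₗ r).compDer (KaehlerDifferential.D R B), ?_⟩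
  ext a
  have hra : r (KaehlerDifferential.D R B (algebraMap A B a)) =
      1 ⊗ₜ KaehlerDifferential.D R A a := by
    have := LinearMap.congr_fun hr (1 ⊗ₜ KaehlerDifferential.D R A a)
    rwa [LinearMap.comp_apply, KaehlerDifferential.mapBaseChange_tmul, one_smul,
      KaehlerDifferential.map_D] at this
  calc f (r (KaehlerDifferential.D R B (algebraMap A B a)))
      = f (1 ⊗ₜ KaehlerDifferential.D R A a) := by rw [hra]
    _ = d.liftKaehlerDifferential (KaehlerDifferential.D R A a) := IsBaseChange.lift_eq _ _ _
    _ = d a := d.liftKaehlerDifferential_comp_D a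

theorem formallySmooth_of_essFiniteType {K A L : Type*} [Field K] [CharZero K] [CommRing A]
    [IsDomain A] [Algebra K A] [Field L] [Algebra K L] [Algebra A L] [IsScalarTower K A L]
    [FaithfulSMul A L] [Algebra.EssFiniteType K L] : Algebra.FormallySmooth A L := by
  let F := FractionRing A
  have : CharZero F := charZero_of_injective_algebraMap (algebraMap K F).injective
  let _ : Algebra F L := FractionRing.liftAlgebra A L
  have : IsScalarTower K F L := IsScalarTower.to₁₃₄ K A F L
  have : Algebra.EssFiniteType F L := Algebra.EssFiniteType.of_comp K F L
  have : Algebra.FormallySmooth A F :=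
    Algebra.FormallySmooth.of_isLocalization (nonZeroDivisors A)
  exact Algebra.FormallySmooth.comp A F L

theorem derivation_eq_zero_of_isIntegral {R S A M : Type*} [CommRing R] [CommRing S] [IsDomain S]
    [CharZero S] [IsIntegrallyClosed S] [CommRing A] [IsDomain A] [Algebra R A] [Algebra S A]
    [FaithfulSMul S A] [Algebra.IsIntegral S A] [AddCommGroup M] [Module R M] [Module S M]
    [Module A M] [IsScalarTower S A M] [Module.IsTorsionFree A M] {d : Derivation R A M}
    (hd : ∀ s : S, d (algebraMap S A s) = 0) : d = 0 := by
  let D : Derivation S A M := Derivation.mk'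
    { toFun := d
      map_add' := map_add d
      map_smul' := fun s a => by
        rw [Algebra.smul_def, d.leibniz, hd, smul_zero, add_zero, RingHom.id_apply,
          algebraMap_smul] } d.leibniz
  ext a
  have ha := Algebra.IsIntegral.isIntegral (R := S) a
  have hzero : Polynomial.aeval a (Polynomial.derivative (minpoly S a)) • D a = 0 := by
    rw [← D.map_aeval, minpoly.aeval, map_zero]
  refine (smul_eq_zero.1 hzero).resolve_left fun h => ?_
  have hne : Polynomial.derivative (minpoly S a) ≠ 0 :=
    mt Polynomial.derivative_eq_zero.1 (minpoly.natDegree_pos ha).ne'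
  exact (minpoly.IsIntegrallyClosed.degree_le_of_ne_zero hne h).not_gt
    (Polynomial.degree_derivative_lt (minpoly.ne_zero ha))

theorem compAlgebraMap_bijective_of_isIntegral {K S A L : Type*} [Field K] [CharZero K]
    [CommRing S] [IsDomain S] [IsIntegrallyClosed S] [CommRing A] [IsDomain A] [Algebra K S]
    [Algebra K A] [Algebra S A] [IsScalarTower K S A] [FaithfulSMul S A] [Algebra.IsIntegral S A]
    [Field L] [Algebra K L] [Algebra S L] [Algebra A L] [IsScalarTower K S L] [IsScalarTower K A L]
    [IsScalarTower S A L] [FaithfulSMul A L] [Algebra.EssFiniteType K L] :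
    Function.Bijective fun d : Derivation K A L => d.compAlgebraMap S := by
  have : FaithfulSMul S L := FaithfulSMul.trans S A L
  constructor
  · intro d d' hdd'
    have : CharZero S := charZero_of_injective_algebraMap (algebraMap K S).injective
    rw [← sub_eq_zero]
    refine derivation_eq_zero_of_isIntegral (S := S) fun s => ?_
    exact sub_eq_zero.2 (Derivation.congr_fun hdd' s)
  · intro d
    have := formallySmooth_of_essFiniteType (K := K) (A := S) (L := L)
    obtain ⟨D, rfl⟩ := exists_derivation_compAlgebraMap_eq (B := L) d
    refine ⟨D.compAlgebraMap A, Derivation.ext fun s => ?_⟩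
    exact congrArg D (IsScalarTower.algebraMap_apply S A L s).symm

theorem ringKrullDim_eq_of_isIntegral {S A : Type*} [CommRing S] [CommRing A] [IsDomain A]
    [Algebra S A] [Algebra.IsIntegral S A] [FaithfulSMul S A] :
    ringKrullDim A = ringKrullDim S := by
  have h := FaithfulSMul.algebraMap_injective S A
  apply le_antisymm
  · refine Order.krullDim_le_of_strictMono (PrimeSpectrum.comap (algebraMap S A)) fun P Q hPQ => ?_
    exact Ideal.IsIntegral.comap_lt_comap (I := P.asIdeal) (J := Q.asIdeal) hPQ
  · refine iSup_le fun l => ?_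
    obtain ⟨P, hP, hPl⟩ := Ideal.exists_ideal_over_prime_of_isIntegral_of_isDomain (S := A)
      l.head.asIdeal (by rw [(RingHom.injective_iff_ker_eq_bot _).1 h]; exact bot_le)
    have : P.LiesOver l.head.asIdeal := ⟨hPl.symm⟩
    obtain ⟨l', hl', -⟩ := Ideal.exists_ltSeries_of_hasGoingUp l P
    rw [← hl']
    exact Order.LTSeries.length_le_krullDim l'

theorem ringKrullDim_eq_finrank_derivation {K A L : Type*} [Field K] [CharZero K] [CommRing A]
    [IsDomain A] [Algebra K A] [Algebra.FiniteType K A] [Field L] [Algebra K L] [Algebra A L]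
    [IsScalarTower K A L] [FaithfulSMul A L] [Algebra.EssFiniteType K L] :
    ringKrullDim A = Module.finrank L (Derivation K A L) := by
  obtain ⟨e, g, hg, hint⟩ := exists_integral_inj_algHom_of_fg K A
  let S := MvPolynomial (Fin e) K
  let _ : Algebra S A := g.toRingHom.toAlgebra
  let _ : Algebra S L := ((algebraMap A L).comp g.toRingHom).toAlgebra
  have : IsScalarTower K S A := IsScalarTower.of_algHom g
  have : IsScalarTower S A L := IsScalarTower.of_algebraMap_eq fun _ => rfl
  have : IsScalarTower K S L := IsScalarTower.to₁₂₄ K S A L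
  have : Algebra.IsIntegral S A := ⟨hint⟩
  have : FaithfulSMul S A := (faithfulSMul_iff_algebraMap_injective S A).2 hg
  have hbij := compAlgebraMap_bijective_of_isIntegral (K := K) (S := S) (A := A) (L := L)
  let T : Derivation K A L →ₗ[L] (Fin e → L) :=
    { toFun := fun d j => d (algebraMap S A (X j))
      map_add' := fun _ _ => rfl
      map_smul' := fun _ _ => rfl }
  have hT : Function.Bijective T :=
    (mkDerivationEquiv (A := L) K).symm.bijective.comp hbij
  rw [(LinearEquiv.ofBijective T hT).finrank_eq, Module.finrank_fintype_fun_eq_card,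
    Fintype.card_fin, ringKrullDim_eq_of_isIntegral (S := S), 
    MvPolynomial.ringKrullDim_of_isNoetherianRing, ringKrullDim_eq_zero_of_field, zero_add]
  simp

end Derivation

section GenericPoint

variable {K σ : Type*} [Field K]

/-- `ψ` is a generic point, with values in an extension `L` of `K`, of the variety with ideal
`p`. -/
def IsGenericPoint {L : Type*} [Field L] [Algebra K L] (p : Ideal (MvPolynomial σ K))
    (ψ : σ → L) : Prop :=
  ∀ P, aeval ψ P = 0 ↔ P ∈ p

section Tangent

variable [Fintype σ] {L : Type*} [Field L] [Algebra K L] {p : Ideal (MvPolynomial σ K)} {ψ : σ → L}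

theorem IsGenericPoint.exists_derivation_range (hψ : IsGenericPoint p ψ) {w : σ → L}
    (hw : w ∈ tangentAt (p : Set (MvPolynomial σ K)) ψ) :
    ∃ d : Derivation K (aeval ψ : MvPolynomial σ K →ₐ[K] L).range L,
      ∀ i, d ((aeval ψ).rangeRestrict (X i)) = w i := by
  classical
  let f := (aeval ψ : MvPolynomial σ K →ₐ[K] L).rangeRestrict
  have hf : Function.Surjective f := AlgHom.rangeRestrict_surjective _
  let G : MvPolynomial σ K →ₗ[K] L :=
    { toFun := fun P => grad ψ P ⬝ᵥ w
      map_add' := fun P Q => by simp [grad, dotProduct, add_mul, Finset.sum_add_distrib]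
      map_smul' := fun c P => by simp [grad, dotProduct, Finset.smul_sum] }
  have hG : ∀ P Q, G (P * Q) = f P • G Q + f Q • G P := by
    intro P Q
    change _ = aeval ψ P * (grad ψ Q ⬝ᵥ w) + aeval ψ Q * (grad ψ P ⬝ᵥ w)
    simp only [G, LinearMap.coe_mk, AddHom.coe_mk, grad, dotProduct, Finset.mul_sum,
      ← Finset.sum_add_distrib]
    refine Finset.sum_congr rfl fun i _ => ?_
    rw [Derivation.leibniz, map_add, smul_eq_mul, smul_eq_mul, map_mul, map_mul]
    ring
  have hker : LinearMap.ker f.toLinearMap ≤ LinearMap.ker G := fun P hP =>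
    mem_tangentAt.1 hw P ((hψ P).1 (congrArg Subtype.val hP))
  let d := (LinearMap.ker f.toLinearMap).liftQ G hker ∘ₗ
    (f.toLinearMap.quotKerEquivOfSurjective hf).symm.toLinearMap
  have hsymm : ∀ P, (f.toLinearMap.quotKerEquivOfSurjective hf).symm (f P) =
      Submodule.Quotient.mk P := fun P => (LinearEquiv.symm_apply_eq _).2 rfl
  have hd : ∀ P, d (f P) = G P := fun P =>
    congrArg ((LinearMap.ker f.toLinearMap).liftQ G hker) (hsymm P)
  refine ⟨Derivation.mk' d (hf.forall₂.2 fun P Q => ?_), fun i => ?_⟩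
  · rw [← map_mul, hd, hd, hd, hG]
  · refine (hd (X i)).trans ?_
    simp [G, grad, dotProduct, Pi.single_apply, apply_ite (aeval ψ)]

variable [CharZero K] [Algebra.EssFiniteType K L]

theorem IsGenericPoint.exists_derivation (hψ : IsGenericPoint p ψ) {w : σ → L}
    (hw : w ∈ tangentAt (p : Set (MvPolynomial σ K)) ψ) :
    ∃ D : Derivation K L L, ∀ i, D (ψ i) = w i := by
  obtain ⟨d, hd⟩ := hψ.exists_derivation_range hw
  have := formallySmooth_of_essFiniteType (K := K)
    (A := (aeval ψ : MvPolynomial σ K →ₐ[K] L).range) (L := L)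
  obtain ⟨D, rfl⟩ := exists_derivation_compAlgebraMap_eq (B := L) d
  refine ⟨D, fun i => ?_⟩
  rw [← hd, Derivation.compAlgebraMap_apply]
  simp

theorem IsGenericPoint.ringKrullDim_eq (hψ : IsGenericPoint p ψ) :
    ringKrullDim (MvPolynomial σ K ⧸ p) =
      Module.finrank L (tangentAt (p : Set (MvPolynomial σ K)) ψ) := by
  let f := (aeval ψ : MvPolynomial σ K →ₐ[K] L).rangeRestrict
  have hf : Function.Surjective f := AlgHom.rangeRestrict_surjective _
  obtain rfl : RingHom.ker f = p := by
    ext P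
    rw [← hψ, RingHom.mem_ker, ← Subtype.coe_inj]
    rfl
  have : Algebra.FiniteType K (aeval ψ : MvPolynomial σ K →ₐ[K] L).range :=
    Algebra.FiniteType.of_surjective f hf
  have hd : ∀ (d : Derivation K (aeval ψ : MvPolynomial σ K →ₐ[K] L).range L) (P),
      d (f P) = grad ψ P ⬝ᵥ fun i => d (f (X i)) := by
    intro d P
    have := derivation_aeval d (f ∘ X) P
    rwa [← aeval_unique] at this
  let T : Derivation K (aeval ψ : MvPolynomial σ K →ₐ[K] L).range L →ₗ[L]
      tangentAt (RingHom.ker f : Set (MvPolynomial σ K)) ψ := LinearMap.codRestrict _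
    { toFun := fun d i => d (f (X i))
      map_add' := fun _ _ => rfl
      map_smul' := fun _ _ => rfl } fun d => mem_tangentAt.2 fun P hP => by
        rw [LinearMap.coe_mk, AddHom.coe_mk, ← hd, hP, map_zero]
  have hT : Function.Bijective T := by
    constructor
    · intro d d' h
      refine Derivation.ext (hf.forall.2 fun P => ?_)
      rw [hd, hd]
      exact congrArg (fun u => grad ψ P ⬝ᵥ u.1) h
    · rintro ⟨w, hw⟩
      obtain ⟨d, h⟩ := hψ.exists_derivation_range hw
      exact ⟨d, Subtype.ext (funext h)⟩
  rw [← (LinearEquiv.ofBijective T hT).finrank_eq, ← ringKrullDim_eq_finrank_derivation (K := K)]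
  exact ringKrullDim_eq_of_ringEquiv (RingHom.quotientKerEquivOfSurjective hf)

end Tangent

variable (p : Ideal (MvPolynomial σ K))

/-- The generic point of the affine variety with prime ideal `p`, over its function field. -/
def genericPoint (i : σ) : FractionRing (MvPolynomial σ K ⧸ p) :=
  algebraMap _ _ (Ideal.Quotient.mk p (X i))

theorem aeval_genericPoint (P : MvPolynomial σ K) :
    aeval (genericPoint p) P = algebraMap (MvPolynomial σ K ⧸ p)
      (FractionRing (MvPolynomial σ K ⧸ p)) (Ideal.Quotient.mk p P) := by
  have haeval : aeval (genericPoint p) =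
      (IsScalarTower.toAlgHom K _ (FractionRing (MvPolynomial σ K ⧸ p))).comp
        (Ideal.Quotient.mkₐ K p) := by
    ext i
    rw [aeval_X]
    rfl
  rw [haeval]
  rfl

variable [p.IsPrime]

theorem isGenericPoint_genericPoint : IsGenericPoint p (genericPoint p) := by
  intro P
  rw [aeval_genericPoint, map_eq_zero_iff _ (IsFractionRing.injective _ _),
    Ideal.Quotient.eq_zero_iff_mem]

theorem exists_common_denominator {ι : Type*} [Finite ι]
    (v : ι → FractionRing (MvPolynomial σ K ⧸ p)) :
    ∃ c ∉ p, ∃ V : ι → MvPolynomial σ K,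
      ∀ i, aeval (genericPoint p) (V i) = aeval (genericPoint p) c * v i := by
  obtain ⟨⟨b, hb⟩, hbv⟩ := IsLocalization.exist_integer_multiples_of_finite
    (nonZeroDivisors (MvPolynomial σ K ⧸ p)) v
  obtain ⟨c, rfl⟩ := Ideal.Quotient.mk_surjective b
  choose a ha using hbv
  choose V hV using fun i => Ideal.Quotient.mk_surjective (a i)
  refine ⟨c, fun hc => nonZeroDivisors.ne_zero hb (Ideal.Quotient.eq_zero_iff_mem.2 hc), V,
    fun i => ?_⟩
  rw [aeval_genericPoint, hV, ha, aeval_genericPoint, Algebra.smul_def]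

theorem exists_linearIndependent_row_eval {τ ι : Type*} [Finite τ] [Finite ι]
    (J : Matrix ι τ (MvPolynomial σ K))
    (hJ : LinearIndependent (FractionRing (MvPolynomial σ K ⧸ p))
      (J.map (aeval (genericPoint p))).row) :
    ∃ Q ∉ p, ∀ x : σ → K, eval x Q ≠ 0 → LinearIndependent K (J.map (eval x)).row := by
  classical
  have := Fintype.ofFinite ι
  have := Fintype.ofFinite τ
  obtain ⟨R, hR⟩ := exists_mul_eq_one_of_linearIndependent_row hJ
  obtain ⟨c, hc, V, hV⟩ := exists_common_denominator p fun i : τ × ι => R i.1 i.2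
  let R' : Matrix τ ι (MvPolynomial σ K) := Matrix.of fun i j => V (i, j)
  refine ⟨(J * R').det, ?_, fun x hx => ?_⟩
  · have hR' : R'.map (aeval (genericPoint p)) = aeval (genericPoint p) c • R := by
      ext i j
      exact hV (i, j)
    rw [← isGenericPoint_genericPoint, AlgHom.map_det, AlgHom.mapMatrix_apply, Matrix.map_mul, hR',
      Matrix.mul_smul, hR, det_smul, det_one, mul_one]
    exact pow_ne_zero _ (mt (isGenericPoint_genericPoint p c).1 hc)
  · rw [RingHom.map_det, RingHom.mapMatrix_apply, Matrix.map_mul] at hx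
    exact linearIndependent_row_of_det_mul_ne_zero hx

theorem exists_polynomial_derivation [Finite σ]
    (D : Derivation K (FractionRing (MvPolynomial σ K ⧸ p))
      (FractionRing (MvPolynomial σ K ⧸ p))) :
    ∃ c ∉ p, ∃ V : Derivation K (MvPolynomial σ K) (MvPolynomial σ K),
      ∀ P, aeval (genericPoint p) (V P) =
        aeval (genericPoint p) c * D (aeval (genericPoint p) P) := by
  have := Fintype.ofFinite σ
  obtain ⟨c, hc, v, hv⟩ := exists_common_denominator p fun i => D (genericPoint p i)
  refine ⟨c, hc, mkDerivation K v, fun P => ?_⟩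
  have hV := derivation_aeval (mkDerivation K v) X P
  rw [aeval_X_left, AlgHom.id_apply] at hV
  rw [derivation_aeval, hV, map_sum, Finset.mul_sum]
  refine Finset.sum_congr rfl fun i _ => ?_
  rw [mkDerivation_X, smul_eq_mul, map_mul, hv, smul_eq_mul, AlgHom.id_apply]
  ring

end GenericPoint

section Dimension

variable {K σ τ : Type*} [Field K]

theorem eval_derivation [Fintype σ] (V : Derivation K (MvPolynomial σ K) (MvPolynomial σ K))
    (x : σ → K) (P : MvPolynomial σ K) :
    eval x (V P) = grad x P ⬝ᵥ fun s => eval x (V (X s)) := by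
  have hV := derivation_aeval V X P
  rw [aeval_X_left, AlgHom.id_apply] at hV
  rw [hV, map_sum]
  exact Finset.sum_congr rfl fun i _ => map_mul _ _ _

theorem eval_derivation_mem_tangentSpace [Fintype σ] {C : Set (σ → K)}
    {V : Derivation K (MvPolynomial σ K) (MvPolynomial σ K)}
    (hV : ∀ P ∈ vanishingIdeal K C, V P ∈ vanishingIdeal K C) {x : σ → K} (hx : x ∈ C) :
    (fun s => eval x (V (X s))) ∈ tangentSpace C x :=
  mem_tangentSpace.2 fun P hP => (eval_derivation V x P).symm.trans (hV P hP x hx)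

theorem exists_eval_ne_zero {C : Set (σ → K)} {P : MvPolynomial σ K}
    (hP : P ∉ vanishingIdeal K C) : ∃ x ∈ C, eval x P ≠ 0 := by
  by_contra! h
  exact hP h

/-- The closure of `C ⊆ K^σ` is an irreducible variety of dimension `e`. -/
def HasDim (C : Set (σ → K)) (e : ℕ) : Prop :=
  (vanishingIdeal K C).IsPrime ∧ ringKrullDim (MvPolynomial σ K ⧸ vanishingIdeal K C) = e

variable [CharZero K] {C : Set (σ → K)} {e : ℕ}

theorem exists_hasDim [Finite σ] (hC : (vanishingIdeal K C).IsPrime) : ∃ e, HasDim C e :=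
  have := Fintype.ofFinite σ
  ⟨_, hC, (isGenericPoint_genericPoint (vanishingIdeal K C)).ringKrullDim_eq⟩

theorem HasDim.finrank_tangentAt [Fintype σ] (hC : HasDim C e) {L : Type*} [Field L] [Algebra K L]
    [Algebra.EssFiniteType K L] {ψ : σ → L} (hψ : IsGenericPoint (vanishingIdeal K C) ψ) :
    Module.finrank L (tangentAt (vanishingIdeal K C : Set (MvPolynomial σ K)) ψ) = e := by
  have := hψ.ringKrullDim_eq.symm.trans hC.2
  exact_mod_cast this

theorem IsGenericPoint.exists_linearIndependent_derivation [Finite σ] {L : Type*} [Field L]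
    [Algebra K L] [Algebra.EssFiniteType K L] {ψ : σ → L} (hC : HasDim C e)
    (hψ : IsGenericPoint (vanishingIdeal K C) ψ) :
    ∃ D : Fin e → Derivation K L L, LinearIndependent L fun i j => D i (ψ j) := by
  have := Fintype.ofFinite σ
  let u := Module.finBasisOfFinrankEq _ _ (hC.finrank_tangentAt hψ)
  choose D hD using fun i => hψ.exists_derivation (u i).2
  refine ⟨D, ?_⟩
  simp only [hD]
  exact u.linearIndependent.map' (Submodule.subtype _) (Submodule.ker_subtype _)

variable [Fintype σ]

theorem HasDim.exists_finrank_le (hC : HasDim C e) :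
    ∃ Q ∉ vanishingIdeal K C, ∀ x, eval x Q ≠ 0 → Module.finrank K (tangentSpace C x) ≤ e := by
  have := hC.1
  have hfin := hC.finrank_tangentAt (isGenericPoint_genericPoint _)
  obtain ⟨r, f, hfS, hf, hperp⟩ := exists_linearIndependent_perp_range_eq
    (grad (genericPoint (vanishingIdeal K C)) '' (vanishingIdeal K C : Set (MvPolynomial σ K)))
  choose P hP hPf using hfS
  obtain rfl : (fun i => grad (genericPoint _) (P i)) = f := funext hPf
  let J : Matrix (Fin r) σ (MvPolynomial σ K) := Matrix.of fun i j => pderiv j (P i)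
  obtain ⟨Q, hQ, hQx⟩ := exists_linearIndependent_row_eval _ J hf
  refine ⟨Q, hQ, fun x hx => ?_⟩
  have hle : tangentSpace C x ≤ perp (Set.range (J.map (eval x)).row) :=
    tangentSpace_le_perp_range_grad hP x
  refine (Submodule.finrank_mono hle).trans ?_
  have hx' := card_add_finrank_perp_range_row (hQx x hx)
  have hgeneric := card_add_finrank_perp_range_row (J := J.map (aeval (genericPoint _))) hf
  have hperp' : perp (Set.range (J.map (aeval (genericPoint (vanishingIdeal K C)))).row) =
    tangentAt (vanishingIdeal K C : Set (MvPolynomial σ K)) (genericPoint _) := hperp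
  rw [hperp', hfin] at hgeneric
  omega

/-- Generic smoothness. The image of the generic point of `C` is a generic point of `D`, and the
tangent vectors there are derivations of the function field of `C`; clearing denominators turns
these into polynomial vector fields tangent to `C`. -/
theorem HasDim.exists_linearIndependent_diffMap [Finite τ] {D : Set (τ → K)} {d : ℕ}
    (hC : (vanishingIdeal K C).IsPrime) (hD : HasDim D d) (φ : τ → MvPolynomial σ K)
    (hφ : ∀ Q, Q ∈ vanishingIdeal K D ↔ bind₁ φ Q ∈ vanishingIdeal K C) :
    ∃ Q ∉ vanishingIdeal K C, ∀ x ∈ C, eval x Q ≠ 0 →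
      ∃ W : Fin d → σ → K, (∀ i, W i ∈ tangentSpace C x) ∧
        LinearIndependent K fun i => diffMap φ x (W i) := by
  have := Fintype.ofFinite τ
  have hψ := isGenericPoint_genericPoint (vanishingIdeal K C)
  let ψ := genericPoint (vanishingIdeal K C)
  have hη : IsGenericPoint (vanishingIdeal K D) fun j => aeval ψ (φ j) := fun Q => by
    rw [hφ, ← hψ, aeval_bind₁]
  obtain ⟨δ, hδ⟩ := hη.exists_linearIndependent_derivation hD
  choose c hc V hV using fun i => exists_polynomial_derivation _ (δ i)
  have hVC : ∀ i, ∀ P ∈ vanishingIdeal K C, V i P ∈ vanishingIdeal K C := by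
    intro i P hP
    rw [← hψ, hV, (hψ P).2 hP, map_zero, mul_zero]
  obtain ⟨Q, hQ, hQx⟩ := exists_linearIndependent_row_eval (vanishingIdeal K C)
    (Matrix.of fun i j => V i (φ j)) <| by
      convert! hδ.units_smul fun i => Units.mk0 _ (mt (hψ (c i)).1 (hc i)) using 1
      funext i j
      exact hV i (φ j)
  refine ⟨Q, hQ, fun x hx hQ₀ => ⟨fun i s => eval x (V i (X s)),
    fun i => eval_derivation_mem_tangentSpace (hVC i) hx, ?_⟩⟩
  convert! hQx x hQ₀ using 1
  funext i j
  exact (eval_derivation (V i) x (φ j)).symm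

theorem HasDim.le_finrank (hC : HasDim C e) {x : σ → K} (hx : x ∈ C) :
    e ≤ Module.finrank K (tangentSpace C x) := by
  obtain ⟨D, hD, hDle, -⟩ := exists_local_extension C x
  obtain ⟨Q, hQ, hQx⟩ := HasDim.exists_linearIndependent_diffMap hC.1 hC X fun P => by
    rw [bind₁_X_left, AlgHom.id_apply]
  have hDI : D ∉ vanishingIdeal K C := fun h => hD (h x hx)
  obtain ⟨y, hy, hyDQ⟩ := exists_eval_ne_zero (hC.1.mul_notMem hDI hQ)
  rw [map_mul] at hyDQ
  obtain ⟨W, hW, hWind⟩ := hQx y hy (right_ne_zero_of_mul hyDQ)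
  have hWind' : LinearIndependent K fun i => (⟨W i, hW i⟩ : tangentSpace C y) :=
    .of_comp (diffMap X y ∘ₗ Submodule.subtype _) hWind
  refine le_trans ?_ (hDle y (left_ne_zero_of_mul hyDQ))
  simpa using hWind'.fintype_card_le_finrank

theorem HasDim.exists_finrank_eq (hC : HasDim C e) :
    ∃ Q ∉ vanishingIdeal K C, ∀ x ∈ C, eval x Q ≠ 0 →
      Module.finrank K (tangentSpace C x) = e := by
  obtain ⟨Q, hQ, hQx⟩ := hC.exists_finrank_le
  exact ⟨Q, hQ, fun x hx hx₀ => (hQx x hx₀).antisymm (hC.le_finrank hx)⟩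

end Dimension

/-! ### Zariski topology and dimension -/

theorem isIrreducible_image_iff_of_isInducing {Y Z : Type*} [TopologicalSpace Y]
    [TopologicalSpace Z] {f : Y → Z} (hf : Topology.IsInducing f) {s : Set Y} :
    IsIrreducible (f '' s) ↔ IsIrreducible s := by
  refine ⟨fun h => ⟨h.1.of_image, ?_⟩, fun h => h.image f hf.continuous.continuousOn⟩
  rintro U V hU hV
  obtain ⟨U', hU', rfl⟩ := hf.isOpen_iff.1 hU
  obtain ⟨V', hV', rfl⟩ := hf.isOpen_iff.1 hV
  simpa only [← Set.image_inter_preimage, Set.image_nonempty, ← Set.preimage_inter] using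
    h.2 U' V' hU' hV'

theorem topologicalKrullDim_eq_of_openCover {Y : Type*} [TopologicalSpace Y] [Nonempty Y]
    {ι : Type*} {C : ι → Type*} [∀ i, TopologicalSpace (C i)] {f : ∀ i, C i → Y}
    (hf : ∀ i, Topology.IsOpenEmbedding (f i)) (hsurj : ∀ y, ∃ i c, f i c = y) {d : WithBot ℕ∞}
    (hd : ∀ i, Nonempty (C i) → topologicalKrullDim (C i) = d) : topologicalKrullDim Y = d := by
  apply le_antisymm
  · refine iSup_le fun l => ?_
    obtain ⟨y, hy⟩ := l.head.isIrreducible.nonempty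
    obtain ⟨i, c, rfl⟩ := hsurj y
    rw [← hd i ⟨c⟩]
    let e := TopologicalSpace.IrreducibleCloseds.orderIsoOfIsOpenEmbedding (f i) (hf i)
    have hmem : ∀ j, l j ∈ {V : TopologicalSpace.IrreducibleCloseds Y | (f i ⁻¹' V).Nonempty} :=
      fun j => ⟨c, l.monotone (Fin.zero_le j) hy⟩
    let l' : LTSeries (TopologicalSpace.IrreducibleCloseds (C i)) :=
      { length := l.length
        toFun := fun j => e.symm ⟨l j, hmem j⟩
        step := fun j => e.symm.strictMono (l.step j) }
    exact Order.LTSeries.length_le_krullDim l'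
  · obtain ⟨i, c, -⟩ := hsurj (Classical.arbitrary Y)
    rw [← hd i ⟨c⟩]
    exact (hf i).isInducing.topologicalKrullDim_le

attribute [local instance] zariskiTopology

section Zariski

variable {K σ : Type*} [Field K]

theorem isOpen_zariski_iff (O : Set (σ → K)) :
    IsOpen O ↔ ∃ S : Set (MvPolynomial σ K), O = {x | ∃ P ∈ S, eval x P ≠ 0} := by
  rw [← isClosed_compl_iff, isClosed_zariski_iff]
  refine exists_congr fun S => ?_
  rw [compl_eq_comm, eq_comm, Set.compl_ofPred]
  simp only [not_forall, exists_prop]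

theorem isOpen_eval_ne_zero (P : MvPolynomial σ K) : IsOpen {x : σ → K | eval x P ≠ 0} :=
  (isOpen_zariski_iff _).2 ⟨{P}, by simp⟩

theorem isClosed_zeroLocus (I : Ideal (MvPolynomial σ K)) :
    IsClosed (zeroLocus K I : Set (σ → K)) :=
  (isClosed_zariski_iff _).2 ⟨I, rfl⟩

theorem zeroLocus_vanishingIdeal_of_isClosed {C : Set (σ → K)} (hC : IsClosed C) :
    zeroLocus K (vanishingIdeal K C) = C := by
  refine subset_antisymm ?_ (zeroLocus_vanishingIdeal_le C)
  obtain ⟨S, rfl⟩ := (isClosed_zariski_iff _).1 hC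
  exact fun x hx P hP => hx P fun y hy => hy P hP

theorem isPrime_vanishingIdeal_iff {C : Set (σ → K)} :
    (vanishingIdeal K C).IsPrime ↔ IsIrreducible C := by
  rw [← vanishingIdeal_pointToPoint, ← PrimeSpectrum.isIrreducible_iff_vanishingIdeal_isPrime]
  exact isIrreducible_image_iff_of_isInducing ⟨rfl⟩

theorem isPrime_vanishingIdeal_of_exists_eval_mul_ne_zero {C : Set (σ → K)} (hC : C.Nonempty)
    (h : ∀ P Q : MvPolynomial σ K, (∃ x ∈ C, eval x P ≠ 0) → (∃ x ∈ C, eval x Q ≠ 0) →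
      ∃ x ∈ C, eval x (P * Q) ≠ 0) : (vanishingIdeal K C).IsPrime where
  ne_top' htop := by
    obtain ⟨x, hx⟩ := hC
    have h1 : (1 : MvPolynomial σ K) ∈ vanishingIdeal K C := htop ▸ Submodule.mem_top
    exact one_ne_zero ((map_one (eval x)).symm.trans (h1 x hx))
  mem_or_mem' {P Q} hPQ := by
    by_contra! hne
    obtain ⟨x, hx, hx₀⟩ := h P Q (exists_eval_ne_zero hne.1) (exists_eval_ne_zero hne.2)
    exact hx₀ (hPQ x hx)

theorem isPrime_vanishingIdeal_image {Y : Type*} [TopologicalSpace Y]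
    (Z : TopologicalSpace.IrreducibleCloseds Y) {f : Y → σ → K} (hf : Continuous f) :
    (vanishingIdeal K (f '' Z)).IsPrime :=
  isPrime_vanishingIdeal_iff.2 (Z.isIrreducible.image f hf.continuousOn)

theorem image_preimage_zeroLocus {C : Set (σ → K)} (hC : IsClosed C)
    {I : Ideal (MvPolynomial σ K)} (hI : vanishingIdeal K C ≤ I) :
    ((↑) '' ((↑) ⁻¹' zeroLocus K I : Set C) : Set (σ → K)) = zeroLocus K I := by
  rw [Subtype.image_preimage_coe, Set.inter_eq_right]
  exact (zeroLocus_anti_mono hI).trans (zeroLocus_vanishingIdeal_of_isClosed hC).subset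

theorem zeroLocus_vanishingIdeal_image {C : Set (σ → K)} (hC : IsClosed C) {Z : Set C}
    (hZ : IsClosed Z) : zeroLocus K (vanishingIdeal K ((↑) '' Z : Set (σ → K))) = (↑) '' Z :=
  zeroLocus_vanishingIdeal_of_isClosed (hC.isClosedEmbedding_subtypeVal.isClosedMap _ hZ)

variable [IsAlgClosed K] [Finite σ]

theorem isIrreducible_preimage_zeroLocus {C : Set (σ → K)} (hC : IsClosed C)
    (q : PrimeSpectrum (MvPolynomial σ K)) (hq : vanishingIdeal K C ≤ q.asIdeal) :
    IsIrreducible ((↑) ⁻¹' zeroLocus K q.asIdeal : Set C) := by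
  rw [← isIrreducible_image_iff_of_isInducing Topology.IsInducing.subtypeVal,
    image_preimage_zeroLocus hC hq, ← isPrime_vanishingIdeal_iff, IsPrime.vanishingIdeal_zeroLocus]
  exact q.isPrime

/-- The irreducible closed subset of `C` cut out by a prime ideal containing the ideal of `C`. -/
def irreducibleClosedsOfPrime {C : Set (σ → K)} (hC : IsClosed C)
    (q : PrimeSpectrum.zeroLocus (vanishingIdeal K C : Set (MvPolynomial σ K))) :
    TopologicalSpace.IrreducibleCloseds C where
  carrier := Subtype.val ⁻¹' zeroLocus K q.1.asIdeal
  isIrreducible' := isIrreducible_preimage_zeroLocus hC q.1 q.2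
  isClosed' := (isClosed_zeroLocus _).preimage continuous_subtype_val

/-- The Nullstellensatz as an order-reversing bijection between the irreducible closed subsets of
`C` and the prime ideals containing the ideal of `C`. -/
def irreducibleClosedsOrderIso {C : Set (σ → K)} (hC : IsClosed C) :
    TopologicalSpace.IrreducibleCloseds C ≃o
      (PrimeSpectrum.zeroLocus (vanishingIdeal K C : Set (MvPolynomial σ K)))ᵒᵈ where
  toFun Z := OrderDual.toDual ⟨⟨vanishingIdeal K ((↑) '' (Z : Set C) : Set (σ → K)),
    isPrime_vanishingIdeal_image Z continuous_subtype_val⟩, vanishingIdeal_anti_mono (by simp)⟩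
  invFun q := irreducibleClosedsOfPrime hC (OrderDual.ofDual q)
  left_inv Z := by
    apply SetLike.coe_injective
    change ((↑) ⁻¹' zeroLocus K (vanishingIdeal K ((↑) '' (Z : Set C) : Set (σ → K))) : Set C) = Z
    rw [zeroLocus_vanishingIdeal_image hC Z.isClosed]
    exact Set.preimage_image_eq _ Subtype.val_injective
  right_inv q := OrderDual.ofDual.injective <| Subtype.ext <| PrimeSpectrum.ext <| by
    have hq : vanishingIdeal K (zeroLocus K (OrderDual.ofDual q).1.asIdeal) =
      (OrderDual.ofDual q).1.asIdeal := IsPrime.vanishingIdeal_zeroLocus _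
    rw [← image_preimage_zeroLocus hC (OrderDual.ofDual q).2] at hq
    exact hq
  map_rel_iff' {Z W} := by
    refine ⟨fun h => ?_, fun h => vanishingIdeal_anti_mono (Set.image_mono h)⟩
    have h' : zeroLocus K (vanishingIdeal K ((↑) '' (Z : Set C) : Set (σ → K))) ⊆
      zeroLocus K (vanishingIdeal K ((↑) '' (W : Set C) : Set (σ → K))) := zeroLocus_anti_mono h
    rw [zeroLocus_vanishingIdeal_image hC Z.isClosed,
      zeroLocus_vanishingIdeal_image hC W.isClosed] at h'
    exact (Set.image_subset_image_iff Subtype.val_injective).1 h'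

theorem topologicalKrullDim_eq_ringKrullDim {C : Set (σ → K)} (hC : IsClosed C) :
    topologicalKrullDim C = ringKrullDim (MvPolynomial σ K ⧸ vanishingIdeal K C) := by
  rw [ringKrullDim_quotient, ← Order.krullDim_orderDual]
  exact Order.krullDim_eq_of_orderIso (irreducibleClosedsOrderIso hC)

end Zariski

/-! ### Frames of linear subspaces -/

section LinearPoly

variable {K σ τ : Type*} [Field K]

theorem isClosed_singleton (x : σ → K) : IsClosed ({x} : Set (σ → K)) := by
  refine (isClosed_zariski_iff _).2 ⟨Set.range fun i => X i - C (x i), ?_⟩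
  ext y
  simp [sub_eq_zero, funext_iff]

theorem vanishingIdeal_eval_ne_zero [Infinite K] {P : MvPolynomial σ K} (hP : P ≠ 0) :
    vanishingIdeal K {x : σ → K | eval x P ≠ 0} = ⊥ := by
  refine (Submodule.eq_bot_iff _).2 fun Q hQ => (mul_eq_zero.1 ?_).resolve_right hP
  refine MvPolynomial.funext fun x => ?_
  by_cases hx : eval x P = 0
  · rw [map_mul, hx, mul_zero, map_zero]
  · rw [map_mul, map_zero, show eval x Q = 0 from hQ x hx, zero_mul]

section Coordinates

variable [Fintype σ]

/-- The coordinates of a linear map between affine spaces, as linear forms. -/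
def linearPoly (f : (σ → K) →ₗ[K] (τ → K)) (j : τ) : MvPolynomial σ K :=
  ∑ i, C (f (Pi.basisFun K σ i) j) * X i

theorem eval_linearPoly (f : (σ → K) →ₗ[K] (τ → K)) (x : σ → K) :
    (fun j => eval x (linearPoly f j)) = f x := by
  funext j
  conv_rhs => rw [← (Pi.basisFun K σ).sum_repr x]
  simp [linearPoly, mul_comm]

theorem eval_bind₁_linearPoly (f : (σ → K) →ₗ[K] (τ → K)) (x : σ → K) (P : MvPolynomial τ K) :
    eval x (bind₁ (linearPoly f) P) = eval (f x) P := by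
  rw [← eval_linearPoly]
  exact aeval_bind₁ x _ P

theorem diffMap_linearPoly (f : (σ → K) →ₗ[K] (τ → K)) (x w : σ → K) :
    diffMap (linearPoly f) x w = f w := by
  funext j
  have h := eval_derivation (mkDerivation K fun i => C (w i)) x (linearPoly f j)
  simp only [mkDerivation_X, eval_C] at h
  rw [diffMap_apply, ← h, ← eval_linearPoly]
  simp [linearPoly]

theorem map_mem_tangentSpace [Fintype τ] {C : Set (σ → K)} {D : Set (τ → K)}
    {f : (σ → K) →ₗ[K] (τ → K)} (hf : Set.MapsTo f C D) {x w : σ → K}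
    (hw : w ∈ tangentSpace C x) : f w ∈ tangentSpace D (f x) := by
  have h := diffMap_mem_tangentSpace (linearPoly f) (D := D)
    (fun x hx => by simpa only [eval_linearPoly] using hf hx) hw
  rwa [eval_linearPoly, diffMap_linearPoly] at h

theorem tangentSpace_singleton (x y : σ → K) : tangentSpace {x} y = ⊥ := by
  refine (Submodule.eq_bot_iff _).2 fun w hw => funext fun i => ?_
  have h := hw (X i - C (x i)) (by simp)
  classical
  simpa [pderiv_X, Pi.single_apply, apply_ite] using h

end Coordinates

theorem continuous_linearMap [Finite σ] (f : (σ → K) →ₗ[K] (τ → K)) : Continuous f := by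
  have := Fintype.ofFinite σ
  rw [continuous_iff_isClosed]
  intro Z hZ
  obtain ⟨S, rfl⟩ := (isClosed_zariski_iff _).1 hZ
  refine (isClosed_zariski_iff _).2 ⟨bind₁ (linearPoly f) '' S, ?_⟩
  ext x
  simp [eval_bind₁_linearPoly]

end LinearPoly

section MatrixAction

variable {K ι κ : Type*} [Field K]

/-- A point of affine space indexed by `ι × κ`, as a matrix. -/
def rows : (ι × κ → K) ≃ₗ[K] Matrix ι κ K := LinearEquiv.curry K K ι κ

theorem map_eval_mvPolynomialX (M : ι × κ → K) : (mvPolynomialX ι κ K).map (eval M) = rows M :=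
  mvPolynomialX_map_eval₂ (RingHom.id K) (rows M)

section RightMultiplication

variable [Fintype κ]

/-- Right multiplication by `R`, on coordinates. -/
def mulRight (R : Matrix κ ι K) : (ι × κ → K) →ₗ[K] (ι × ι → K) :=
  rows.symm.toLinearMap ∘ₗ mulRightLinearMap ι K R ∘ₗ rows.toLinearMap

theorem mulRight_apply (R : Matrix κ ι K) (M : ι × κ → K) :
    mulRight R M = rows.symm (rows M * R) := rfl

/-- The product of the generic `ι × κ` matrix with `R`. -/
def genericMul (R : Matrix κ ι K) : Matrix ι ι (MvPolynomial (ι × κ) K) :=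
  (mvPolynomialX ι κ K : Matrix ι κ (MvPolynomial (ι × κ) K)) *
    (R.map C : Matrix κ ι (MvPolynomial (ι × κ) K))

theorem map_eval_genericMul (R : Matrix κ ι K) (M : ι × κ → K) :
    (genericMul R).map (eval M) = rows M * R := by
  rw [genericMul, Matrix.map_mul, map_eval_mvPolynomialX]
  simp [Matrix.map_map, Function.comp_def]

end RightMultiplication

variable [Fintype ι]

/-- Multiplication of an `ι × κ` matrix by a square matrix on the left, which for `κ` the set of
coordinates changes the frame of a linear subspace. -/
def act : Matrix ι ι K →ₗ[K] (ι × κ → K) →ₗ[K] (ι × κ → K) :=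
  LinearMap.mk₂ K (fun g M => rows.symm (g * rows M))
    (fun g h M => by rw [Matrix.add_mul, map_add])
    (fun c g M => by rw [Matrix.smul_mul, map_smul])
    (fun g M M' => by rw [map_add, Matrix.mul_add, map_add])
    (fun c g M => by rw [map_smul, Matrix.mul_smul, map_smul])

theorem rows_act (g : Matrix ι ι K) (M : ι × κ → K) : rows (act g M) = g * rows M := rfl

theorem act_act (g h : Matrix ι ι K) (M : ι × κ → K) : act g (act h M) = act (g * h) M :=
  rows.injective (by rw [rows_act, rows_act, rows_act, Matrix.mul_assoc])

/-- The orbit map `g ↦ g * M` of the action of square matrices, on coordinates. -/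
def orbitMap (M : ι × κ → K) : (ι × ι → K) →ₗ[K] (ι × κ → K) :=
  act.flip M ∘ₗ (rows : (ι × ι → K) ≃ₗ[K] Matrix ι ι K).toLinearMap

theorem orbitMap_apply (M : ι × κ → K) (g : ι × ι → K) : orbitMap M g = act (rows g) M := rfl

variable [DecidableEq ι]

theorem act_one (M : ι × κ → K) : act 1 M = M :=
  rows.injective (by rw [rows_act, Matrix.one_mul])

theorem act_inv_act {g : Matrix ι ι K} (hg : g.det ≠ 0) (M : ι × κ → K) :
    act g⁻¹ (act g M) = M := by
  rw [act_act, nonsing_inv_mul _ hg.isUnit, act_one]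

theorem det_inv_ne_zero {g : Matrix ι ι K} (hg : g.det ≠ 0) : g⁻¹.det ≠ 0 :=
  (isUnit_nonsing_inv_det _ hg.isUnit).ne_zero

theorem vanishingIdeal_det_ne_zero [Infinite K] :
    vanishingIdeal K {g : ι × ι → K | (rows g).det ≠ 0} = ⊥ := by
  convert vanishingIdeal_eval_ne_zero (det_mvPolynomialX_ne_zero ι K) using 4
  rw [eval_det_mvPolynomialX]
  rfl

variable [Fintype κ]

/-- The polynomial `M ↦ det (M * R)`. -/
def chartDet (R : Matrix κ ι K) : MvPolynomial (ι × κ) K := (genericMul R).det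

theorem eval_chartDet (R : Matrix κ ι K) (M : ι × κ → K) :
    eval M (chartDet R) = (rows M * R).det := by
  rw [chartDet, RingHom.map_det, RingHom.mapMatrix_apply, map_eval_genericMul]

theorem exists_eval_eq_det_mul_act_inv (R : Matrix κ ι K) (p : ι × κ) :
    ∃ A : MvPolynomial (ι × κ) K, ∀ M : ι × κ → K, (rows M * R).det ≠ 0 →
      eval M A = (rows M * R).det * act (rows M * R)⁻¹ M p := by
  let A := (genericMul R).adjugate * (mvPolynomialX ι κ K : Matrix ι κ (MvPolynomial (ι × κ) K))
  refine ⟨A p.1 p.2, fun M hM => ?_⟩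
  have hA : A.map (eval M) = (rows M * R).adjugate * rows M := by
    rw [Matrix.map_mul, ← RingHom.mapMatrix_apply, RingHom.map_adjugate, RingHom.mapMatrix_apply,
      map_eval_genericMul, map_eval_mvPolynomialX]
  rw [Matrix.inv_def, Ring.inverse_eq_inv', map_smul, LinearMap.smul_apply, Pi.smul_apply,
    smul_eq_mul, mul_inv_cancel_left₀ hM]
  exact congrFun (congrFun hA p.1) p.2

theorem exists_eval_eq_pow_mul_eval_act_inv (R : Matrix κ ι K) (P : MvPolynomial (ι × κ) K) :
    ∃ (d : ℕ) (Q : MvPolynomial (ι × κ) K), ∀ M : ι × κ → K, (rows M * R).det ≠ 0 →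
      eval M Q = (rows M * R).det ^ d * eval (act (rows M * R)⁻¹ M) P := by
  induction P using MvPolynomial.induction_on with
  | C a => exact ⟨0, C a, fun M _ => by simp⟩
  | add P P' hP hP' =>
    obtain ⟨d, Q, h⟩ := hP
    obtain ⟨d', Q', h'⟩ := hP'
    refine ⟨d + d', chartDet R ^ d' * Q + chartDet R ^ d * Q', fun M hM => ?_⟩
    rw [map_add, map_mul, map_mul, map_pow, map_pow, eval_chartDet, h M hM, h' M hM, map_add]
    ring
  | mul_X P p hP =>
    obtain ⟨d, Q, h⟩ := hP
    obtain ⟨A, hA⟩ := exists_eval_eq_det_mul_act_inv R p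
    refine ⟨d + 1, Q * A, fun M hM => ?_⟩
    rw [map_mul, map_mul, h M hM, hA M hM, eval_X]
    ring

end MatrixAction

section RowSpace

variable {K ι κ : Type*} [Field K] [Fintype ι]

theorem span_row_mul_le (g : Matrix ι ι K) (A : Matrix ι κ K) :
    Submodule.span K (Set.range (g * A).row) ≤ Submodule.span K (Set.range A.row) := by
  rw [← range_vecMulLinear, ← range_vecMulLinear]
  rintro _ ⟨v, rfl⟩
  exact ⟨v ᵥ* g, vecMul_vecMul v g A⟩

theorem exists_mul_eq_of_span_row_le {A A' : Matrix ι κ K}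
    (h : Submodule.span K (Set.range A'.row) ≤ Submodule.span K (Set.range A.row)) :
    ∃ g : Matrix ι ι K, g * A = A' := by
  choose g hg using fun i => (Submodule.mem_span_range_iff_exists_fun K).1
    (h (Submodule.subset_span ⟨i, rfl⟩))
  refine ⟨of g, Matrix.ext_row fun i => (Eq.trans ?_ (vecMul_eq_sum (g i) A)).trans (hg i)⟩
  rfl

variable [DecidableEq ι]

theorem span_row_mul {g : Matrix ι ι K} (hg : g.det ≠ 0) (A : Matrix ι κ K) :
    Submodule.span K (Set.range (g * A).row) = Submodule.span K (Set.range A.row) := by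
  refine (span_row_mul_le g A).antisymm ?_
  conv_lhs => rw [← Matrix.one_mul A, ← nonsing_inv_mul _ hg.isUnit, Matrix.mul_assoc]
  exact span_row_mul_le _ _

theorem linearIndependent_row_mul {g : Matrix ι ι K} (hg : g.det ≠ 0) {A : Matrix ι κ K}
    (hA : LinearIndependent K A.row) : LinearIndependent K (g * A).row := by
  rw [← vecMul_injective_iff] at hA ⊢
  simp_rw [← vecMul_vecMul]
  exact hA.comp (vecMul_injective_of_isUnit ((isUnit_iff_isUnit_det g).2 hg.isUnit))

theorem det_ne_zero_of_linearIndependent_row_mul {g : Matrix ι ι K} {A : Matrix ι κ K}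
    (h : LinearIndependent K (g * A).row) : g.det ≠ 0 := by
  rw [← vecMul_injective_iff] at h
  simp_rw [← vecMul_vecMul] at h
  have hg : Function.Injective fun v => v ᵥ* g :=
    Function.Injective.of_comp (f := fun v => v ᵥ* A) h
  exact ((isUnit_iff_isUnit_det g).1 (vecMul_injective_iff_isUnit.1 hg)).ne_zero

end RowSpace

section Frames

variable {K : Type*} [Field K] {N k : ℕ} {B : Set (Gr K N k)}

theorem mem_frames_singleton_iff {L : Gr K N k} {M : Fin (k + 1) × Fin (N + 1) → K} :
    M ∈ frames {L} ↔ LinearIndependent K (rows M).row ∧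
      Submodule.span K (Set.range (rows M).row) = L.toSub := by
  constructor
  · rintro ⟨L, rfl, b, hb⟩
    have hM : (rows M).row = L.toSub.subtype ∘ b := funext₂ hb
    rw [hM, Set.range_comp, ← Submodule.map_span, b.span_eq, Submodule.map_subtype_top]
    exact ⟨b.linearIndependent.map' _ (Submodule.ker_subtype _), rfl⟩
  · rintro ⟨h, hL⟩
    let b := (Module.Basis.span h).map (LinearEquiv.ofEq _ _ hL)
    have hb : ∀ i, (b i : Vec K N) = (rows M).row i := fun i =>
      congrArg Subtype.val (Module.Basis.span_apply h i)
    exact ⟨L, rfl, b, fun i j => (congrFun (hb i) j).symm⟩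

theorem mem_frames_iff_exists_singleton {M : Fin (k + 1) × Fin (N + 1) → K} :
    M ∈ frames B ↔ ∃ L ∈ B, M ∈ frames {L} := by
  simp only [frames, Set.mem_singleton_iff, exists_eq_left, Set.mem_ofPred_eq]

theorem mem_frames_iff {M : Fin (k + 1) × Fin (N + 1) → K} :
    M ∈ frames B ↔ ∃ h : LinearIndependent K (rows M).row, spanGr ⟨M, h⟩ ∈ B := by
  rw [mem_frames_iff_exists_singleton]
  constructor
  · rintro ⟨L, hL, hM⟩
    obtain ⟨h, hspan⟩ := mem_frames_singleton_iff.1 hM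
    exact ⟨h, (show spanGr ⟨M, h⟩ = L from Subtype.ext hspan) ▸ hL⟩
  · rintro ⟨h, hL⟩
    exact ⟨_, hL, mem_frames_singleton_iff.2 ⟨h, rfl⟩⟩

theorem frames_singleton_nonempty (L : Gr K N k) : (frames {L}).Nonempty :=
  let b := Module.finBasisOfFinrankEq K L.toSub L.2
  ⟨fun p => (b p.1 : Vec K N) p.2, L, rfl, b, fun _ _ => rfl⟩

theorem eq_of_mem_frames {L L' : Gr K N k} {M : Fin (k + 1) × Fin (N + 1) → K}
    (h : M ∈ frames {L}) (h' : M ∈ frames {L'}) : L = L' :=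
  Subtype.ext ((mem_frames_singleton_iff.1 h).2.symm.trans (mem_frames_singleton_iff.1 h').2)

theorem act_mem_frames {M : Fin (k + 1) × Fin (N + 1) → K} (hM : M ∈ frames B)
    {g : Matrix (Fin (k + 1)) (Fin (k + 1)) K} (hg : g.det ≠ 0) : act g M ∈ frames B := by
  obtain ⟨L, hL, hM⟩ := mem_frames_iff_exists_singleton.1 hM
  obtain ⟨hli, hspan⟩ := mem_frames_singleton_iff.1 hM
  exact mem_frames_iff_exists_singleton.2 ⟨L, hL, mem_frames_singleton_iff.2
    ⟨linearIndependent_row_mul hg hli, (span_row_mul hg _).trans hspan⟩⟩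

theorem exists_act_eq {L : Gr K N k} {M M' : Fin (k + 1) × Fin (N + 1) → K}
    (hM : M ∈ frames {L}) (hM' : M' ∈ frames {L}) :
    ∃ g : Matrix (Fin (k + 1)) (Fin (k + 1)) K, g.det ≠ 0 ∧ act g M = M' := by
  obtain ⟨_, hspan⟩ := mem_frames_singleton_iff.1 hM
  obtain ⟨hli', hspan'⟩ := mem_frames_singleton_iff.1 hM'
  obtain ⟨g, hg⟩ := exists_mul_eq_of_span_row_le (hspan'.trans hspan.symm).le
  exact ⟨g, det_ne_zero_of_linearIndependent_row_mul (hg ▸ hli'), rows.injective hg⟩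

theorem isOpen_exists_frame (Q : MvPolynomial (Fin (k + 1) × Fin (N + 1)) K) :
    IsOpen {L : Gr K N k | ∃ M ∈ frames {L}, eval M Q ≠ 0} := by
  have hpre : spanGr ⁻¹' {L : Gr K N k | ∃ M ∈ frames {L}, eval M Q ≠ 0} =
      Subtype.val ⁻¹' ⋃ g : {g : Matrix (Fin (k + 1)) (Fin (k + 1)) K // g.det ≠ 0},
        {M | eval M (bind₁ (linearPoly (act g.1)) Q) ≠ 0} := by
    ext ⟨M, hM⟩
    have hMf : M ∈ frames {spanGr ⟨M, hM⟩} := mem_frames_iff.2 ⟨hM, rfl⟩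
    simp only [Set.mem_preimage, Set.mem_ofPred_eq, Set.mem_iUnion, eval_bind₁_linearPoly]
    constructor
    · rintro ⟨M', hM', hQ⟩
      obtain ⟨g, hg, rfl⟩ := exists_act_eq hMf hM'
      exact ⟨⟨g, hg⟩, hQ⟩
    · rintro ⟨⟨g, hg⟩, hQ⟩
      exact ⟨_, act_mem_frames hMf hg, hQ⟩
  rw [isOpen_coinduced, hpre]
  exact (isOpen_iUnion fun g => isOpen_eval_ne_zero _).preimage continuous_subtype_val

-- Two dense open subsets of `B` meet at some `L`, and the frames of `L` form an orbit of `GL`,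
-- which is open in an affine space.
theorem isPrime_vanishingIdeal_frames [Infinite K] (hB : IsIrreducible B) :
    (vanishingIdeal K (frames B)).IsPrime := by
  have hne : (frames B).Nonempty := by
    obtain ⟨L, hL⟩ := hB.1
    obtain ⟨M, hM⟩ := frames_singleton_nonempty L
    exact ⟨M, mem_frames_iff_exists_singleton.2 ⟨L, hL, hM⟩⟩
  refine isPrime_vanishingIdeal_of_exists_eval_mul_ne_zero hne fun P Q hP hQ => ?_
  have hopen : ∀ P, (∃ M ∈ frames B, eval M P ≠ 0) →
      (B ∩ {L | ∃ M ∈ frames {L}, eval M P ≠ 0}).Nonempty := by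
    rintro P ⟨M, hM, hMP⟩
    obtain ⟨L, hL, hM⟩ := mem_frames_iff_exists_singleton.1 hM
    exact ⟨L, hL, M, hM, hMP⟩
  obtain ⟨L, hL, ⟨M, hM, hMP⟩, ⟨M', hM', hMQ⟩⟩ :=
    hB.2 _ _ (isOpen_exists_frame P) (isOpen_exists_frame Q) (hopen P hP) (hopen Q hQ)
  obtain ⟨g, -, rfl⟩ := exists_act_eq hM hM'
  have hP' : bind₁ (linearPoly (orbitMap M)) P ≠ 0 := fun h => hMP <| by
    rw [← act_one M, ← rows.apply_symm_apply 1, ← orbitMap_apply, ← eval_bind₁_linearPoly, h,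
      map_zero]
  have hQ' : bind₁ (linearPoly (orbitMap M)) Q ≠ 0 := fun h => hMQ <| by
    rw [← rows.apply_symm_apply g, ← orbitMap_apply, ← eval_bind₁_linearPoly, h, map_zero]
  obtain ⟨h, hdet, hPQ⟩ : ∃ h ∈ {h : Fin (k + 1) × Fin (k + 1) → K | (rows h).det ≠ 0},
      eval h (bind₁ (linearPoly (orbitMap M)) (P * Q)) ≠ 0 :=
    exists_eval_ne_zero <| by
      rw [vanishingIdeal_det_ne_zero, map_mul]
      exact mul_ne_zero hP' hQ'
  rw [eval_bind₁_linearPoly] at hPQ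
  exact ⟨_, act_mem_frames (mem_frames_iff_exists_singleton.2 ⟨L, hL, hM⟩) hdet, hPQ⟩

theorem exists_det_mul_ne_zero {M : Fin (k + 1) × Fin (N + 1) → K} (hM : M ∈ frames B) :
    ∃ R : Matrix (Fin (N + 1)) (Fin (k + 1)) K, (rows M * R).det ≠ 0 := by
  obtain ⟨R, hR⟩ := exists_mul_eq_one_of_linearIndependent_row (mem_frames_iff.1 hM).1
  exact ⟨R, by rw [hR, det_one]; exact one_ne_zero⟩

variable (B) in
theorem act_mem_tangentSpace_act {M w : Fin (k + 1) × Fin (N + 1) → K}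
    {g : Matrix (Fin (k + 1)) (Fin (k + 1)) K} (hg : g.det ≠ 0)
    (hw : w ∈ tangentSpace (frames B) M) : act g w ∈ tangentSpace (frames B) (act g M) :=
  map_mem_tangentSpace (fun _ hM => act_mem_frames hM hg) hw

variable (B) in
theorem finrank_tangentSpace_act (M : Fin (k + 1) × Fin (N + 1) → K)
    {g : Matrix (Fin (k + 1)) (Fin (k + 1)) K} (hg : g.det ≠ 0) :
    Module.finrank K (tangentSpace (frames B) (act g M))
      = Module.finrank K (tangentSpace (frames B) M) := by
  have hle : ∀ (M : Fin (k + 1) × Fin (N + 1) → K) {g : Matrix (Fin (k + 1)) (Fin (k + 1)) K},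
      g.det ≠ 0 → Module.finrank K (tangentSpace (frames B) M)
        ≤ Module.finrank K (tangentSpace (frames B) (act g M)) := fun M g hg => by
    have hinj : Function.Injective (act (κ := Fin (N + 1)) g) :=
      Function.LeftInverse.injective (act_inv_act hg)
    rw [(Submodule.equivMapOfInjective _ hinj _).finrank_eq]
    exact Submodule.finrank_mono
      (Submodule.map_le_iff_le_comap.2 fun w => act_mem_tangentSpace_act B hg)
  refine le_antisymm ?_ (hle M hg)
  exact (hle (act g M) (det_inv_ne_zero hg)).trans_eq (by rw [act_inv_act hg])

theorem act_mem_tangentSpace [Infinite K] {M : Fin (k + 1) × Fin (N + 1) → K}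
    (hM : M ∈ frames B) (g : Matrix (Fin (k + 1)) (Fin (k + 1)) K) :
    act g M ∈ tangentSpace (frames B) M := by
  have hg : rows.symm g ∈ tangentSpace {g : Fin (k + 1) × Fin (k + 1) → K | (rows g).det ≠ 0}
      (rows.symm 1) := mem_tangentSpace.2 fun P hP => by
    rw [vanishingIdeal_det_ne_zero, Ideal.mem_bot] at hP
    simp [hP, grad, dotProduct]
  have h := map_mem_tangentSpace (f := orbitMap M) (D := frames B)
    (fun g hg => act_mem_frames hM hg) hg
  rwa [orbitMap_apply, orbitMap_apply, LinearEquiv.apply_symm_apply, LinearEquiv.apply_symm_apply,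
    act_one] at h

end Frames

section Charts

variable {K : Type*} [Field K] {N k : ℕ} {B : Set (Gr K N k)}
  {R : Matrix (Fin (N + 1)) (Fin (k + 1)) K}

/-- The affine chart of `B` given by `R`: the frames `M` of the members of `B` normalised by
`M * R = 1`. -/
def chart (B : Set (Gr K N k)) (R : Matrix (Fin (N + 1)) (Fin (k + 1)) K) :
    Set (Fin (k + 1) × Fin (N + 1) → K) :=
  {M | M ∈ frames B ∧ rows M * R = 1}

theorem act_inv_mem_chart {M : Fin (k + 1) × Fin (N + 1) → K} (hM : M ∈ frames B)
    (h : (rows M * R).det ≠ 0) : act (rows M * R)⁻¹ M ∈ chart B R :=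
  ⟨act_mem_frames hM (det_inv_ne_zero h), by
    rw [rows_act, Matrix.mul_assoc, nonsing_inv_mul _ h.isUnit]⟩

theorem det_mul_ne_zero_of_mem_chart {M : Fin (k + 1) × Fin (N + 1) → K} (hM : M ∈ chart B R) :
    (rows M * R).det ≠ 0 := by
  rw [hM.2, det_one]
  exact one_ne_zero

theorem isClosed_chart (hB : IsClosed B) (R : Matrix (Fin (N + 1)) (Fin (k + 1)) K) :
    IsClosed (chart B R) := by
  obtain ⟨Z, hZ, hZB⟩ := isClosed_induced_iff.1 (isClosed_coinduced.1 hB)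
  have hchart : chart B R = Z ∩ mulRight R ⁻¹' {rows.symm 1} := by
    ext M
    have hMZ : ∀ h : LinearIndependent K (rows M).row, M ∈ Z ↔ spanGr ⟨M, h⟩ ∈ B := fun h =>
      Set.ext_iff.1 hZB ⟨M, h⟩
    simp only [chart, mem_frames_iff, Set.mem_ofPred_eq, Set.mem_inter_iff, Set.mem_preimage,
      Set.mem_singleton_iff, mulRight_apply, EmbeddingLike.apply_eq_iff_eq]
    refine and_congr_left fun hR => ⟨fun ⟨h, hB⟩ => (hMZ h).2 hB, fun hM => ?_⟩
    have h : LinearIndependent K (rows M).row :=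
      linearIndependent_row_of_det_mul_ne_zero (R := R) (by rw [hR, det_one]; exact one_ne_zero)
    exact ⟨h, (hMZ h).1 hM⟩
  rw [hchart]
  exact hZ.inter ((isClosed_singleton _).preimage (continuous_linearMap _))

/-- The map from the chart to `B` sending a frame to its span. -/
def chartMap (B : Set (Gr K N k)) (R : Matrix (Fin (N + 1)) (Fin (k + 1)) K) (M : chart B R) : B :=
  ⟨spanGr ⟨M.1, (mem_frames_iff.1 M.2.1).1⟩, (mem_frames_iff.1 M.2.1).2⟩

theorem mem_frames_chartMap (M : chart B R) : M.1 ∈ frames {(chartMap B R M).1} :=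
  mem_frames_iff.2 ⟨(mem_frames_iff.1 M.2.1).1, rfl⟩

theorem chartMap_act_inv (L : B) {M : Fin (k + 1) × Fin (N + 1) → K} (hM : M ∈ frames {L.1})
    (h : (rows M * R).det ≠ 0) :
    chartMap B R ⟨act (rows M * R)⁻¹ M,
      act_inv_mem_chart (mem_frames_iff_exists_singleton.2 ⟨L, L.2, hM⟩) h⟩ = L :=
  Subtype.ext (eq_of_mem_frames (mem_frames_chartMap _) (act_inv_mem_chart hM h).1)

theorem continuous_chartMap (B : Set (Gr K N k)) (R : Matrix (Fin (N + 1)) (Fin (k + 1)) K) :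
    Continuous (chartMap B R) := by
  have hspan : Continuous (spanGr : _ → Gr K N k) := continuous_coinduced_rng
  exact (hspan.comp (continuous_subtype_val.subtype_mk fun M =>
    (mem_frames_iff.1 M.2.1).1)).subtype_mk _

theorem injective_chartMap (B : Set (Gr K N k)) (R : Matrix (Fin (N + 1)) (Fin (k + 1)) K) :
    Function.Injective (chartMap B R) := by
  intro M M' h
  obtain ⟨g, -, hg⟩ := exists_act_eq (mem_frames_chartMap M) (h ▸ mem_frames_chartMap M')
  have hg1 : g = 1 := by
    rw [← M'.2.2, ← hg, rows_act, Matrix.mul_assoc, M.2.2, Matrix.mul_one]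
  exact Subtype.ext (by rw [← hg, hg1, act_one])

theorem exists_image_chartMap_eq (B : Set (Gr K N k)) (R : Matrix (Fin (N + 1)) (Fin (k + 1)) K)
    (P : MvPolynomial (Fin (k + 1) × Fin (N + 1)) K) :
    ∃ Q, chartMap B R '' {M | eval M.1 P ≠ 0} =
      Subtype.val ⁻¹' {L : Gr K N k | ∃ M ∈ frames {L}, eval M Q ≠ 0} := by
  obtain ⟨d, Q, hQ⟩ := exists_eval_eq_pow_mul_eval_act_inv R P
  refine ⟨chartDet R * Q, Set.ext fun L => ⟨?_, ?_⟩⟩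
  · rintro ⟨M, hMP, rfl⟩
    refine ⟨M, mem_frames_chartMap M, ?_⟩
    rw [map_mul, eval_chartDet, hQ _ (det_mul_ne_zero_of_mem_chart M.2), M.2.2, inv_one, act_one,
      det_one, one_pow, one_mul, one_mul]
    exact hMP
  · rintro ⟨M, hM, hMQ⟩
    rw [map_mul, eval_chartDet] at hMQ
    have hdet := left_ne_zero_of_mul hMQ
    rw [hQ M hdet] at hMQ
    have hMP := right_ne_zero_of_mul (right_ne_zero_of_mul hMQ)
    exact ⟨⟨act (rows M * R)⁻¹ M, _⟩, hMP, chartMap_act_inv L hM hdet⟩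

theorem isOpenEmbedding_chartMap (B : Set (Gr K N k)) (R : Matrix (Fin (N + 1)) (Fin (k + 1)) K) :
    Topology.IsOpenEmbedding (chartMap B R) := by
  refine .of_continuous_injective_isOpenMap (continuous_chartMap B R) (injective_chartMap B R) ?_
  rintro _ ⟨W, hW, rfl⟩
  obtain ⟨S, rfl⟩ := (isOpen_zariski_iff _).1 hW
  choose Q hQ using exists_image_chartMap_eq B R
  have hunion : Subtype.val ⁻¹' {x | ∃ P ∈ S, eval x P ≠ 0}
      = ⋃ P ∈ S, {M : chart B R | eval M.1 P ≠ 0} := by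
    ext M
    simp
  rw [hunion, Set.image_iUnion₂]
  refine isOpen_biUnion fun P _ => ?_
  rw [hQ]
  exact (isOpen_exists_frame _).preimage continuous_subtype_val

theorem isIrreducible_chart (hB : IsIrreducible B) (hne : (chart B R).Nonempty) :
    IsIrreducible (chart B R) := by
  have := Subtype.irreducibleSpace hB
  have := hne.to_subtype
  have := (isOpenEmbedding_chartMap B R).irreducibleSpace
  exact IsIrreducible.of_subtype

theorem exists_chart_nonempty (hB : B.Nonempty) : ∃ R, (chart B R).Nonempty := by
  obtain ⟨L, hL⟩ := hB
  obtain ⟨M, hM⟩ := frames_singleton_nonempty L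
  obtain ⟨R, hR⟩ := exists_det_mul_ne_zero hM
  exact ⟨R, _, act_inv_mem_chart (mem_frames_iff_exists_singleton.2 ⟨L, hL, hM⟩) hR⟩

theorem topologicalKrullDim_eq_of_chart (hB : B.Nonempty) {d : WithBot ℕ∞}
    (hd : ∀ R, (chart B R).Nonempty → topologicalKrullDim (chart B R) = d) :
    topologicalKrullDim B = d := by
  have := hB.to_subtype
  refine topologicalKrullDim_eq_of_openCover (isOpenEmbedding_chartMap B) (fun L => ?_)
    fun R h => hd R (Set.nonempty_coe_sort.1 h)
  obtain ⟨M, hM⟩ := frames_singleton_nonempty L.1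
  obtain ⟨R, hR⟩ := exists_det_mul_ne_zero hM
  exact ⟨R, _, chartMap_act_inv L hM hR⟩

theorem mem_tangentSpace_of_mem_chart {M w : Fin (k + 1) × Fin (N + 1) → K}
    (hw : w ∈ tangentSpace (chart B R) M) : w ∈ tangentSpace (frames B) M ∧ rows w * R = 0 := by
  refine ⟨map_mem_tangentSpace (f := LinearMap.id) (fun _ h => h.1) hw, ?_⟩
  have h := map_mem_tangentSpace (f := mulRight R) (D := {rows.symm 1})
    (fun M hM => by rw [mulRight_apply, hM.2]; rfl) hw
  rw [tangentSpace_singleton, Submodule.mem_bot, mulRight_apply] at h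
  exact rows.symm.map_eq_zero_iff.1 h

-- Homogenising a polynomial `P` which vanishes on the chart gives one which vanishes on the frames
-- and agrees with `P` on the line from `M` in the direction `w`.
theorem mem_tangentSpace_chart [Infinite K] {M w : Fin (k + 1) × Fin (N + 1) → K}
    (hM : M ∈ chart B R) (hw : w ∈ tangentSpace (frames B) M) (hwR : rows w * R = 0) :
    w ∈ tangentSpace (chart B R) M := by
  rw [mem_tangentSpace] at hw ⊢
  intro P hP
  obtain ⟨d, Q, hQ⟩ := exists_eval_eq_pow_mul_eval_act_inv R P
  have hQB : chartDet R * Q ∈ vanishingIdeal K (frames B) := by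
    intro x hx
    rw [MvPolynomial.aeval_eq_eval, map_mul, eval_chartDet]
    by_cases hdet : (rows x * R).det = 0
    · rw [hdet, zero_mul]
    · have hPx : eval (act (rows x * R)⁻¹ x) P = 0 := hP _ (act_inv_mem_chart hx hdet)
      rw [hQ x hdet, hPx, mul_zero, mul_zero]
  rw [← hw _ hQB]
  refine (grad_dotProduct_congr fun t => ?_).symm
  have hline : rows (M + t • w) * R = 1 := by
    rw [map_add, map_smul, Matrix.add_mul, Matrix.smul_mul, hwR, hM.2, smul_zero, add_zero]
  rw [map_mul, eval_chartDet, hQ _ (by rw [hline, det_one]; exact one_ne_zero), hline, inv_one,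
    act_one, det_one, one_pow, one_mul, one_mul]

theorem finrank_tangentSpace_chart [Infinite K] {M : Fin (k + 1) × Fin (N + 1) → K}
    (hM : M ∈ chart B R) : Module.finrank K (tangentSpace (frames B) M)
      = Module.finrank K (tangentSpace (chart B R) M) + (k + 1) * (k + 1) := by
  let T := (mulRightLinearMap (Fin (k + 1)) K R ∘ₗ rows.toLinearMap).domRestrict
    (tangentSpace (frames B) M)
  have hrange : LinearMap.range T = ⊤ := LinearMap.range_eq_top.2 fun g =>
    ⟨⟨act g M, act_mem_tangentSpace hM.1 g⟩, by
      change rows (act g M) * R = g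
      rw [rows_act, Matrix.mul_assoc, hM.2, Matrix.mul_one]⟩
  have hker : (LinearMap.ker T).map (tangentSpace (frames B) M).subtype
      = tangentSpace (chart B R) M := by
    ext w
    constructor
    · rintro ⟨⟨w, hw⟩, hwR, rfl⟩
      exact mem_tangentSpace_chart hM hw hwR
    · exact fun h => let ⟨hw, hwR⟩ := mem_tangentSpace_of_mem_chart h
        ⟨⟨w, hw⟩, hwR, rfl⟩
  have h := LinearMap.finrank_range_add_finrank_ker T
  rw [hrange, finrank_top, ← Submodule.finrank_map_subtype_eq, hker, Module.finrank_matrix,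
    Fintype.card_fin, Module.finrank_self, mul_one] at h
  rw [← h, add_comm]

theorem HasDim.eq_of_chart [CharZero K] {d e : ℕ} (he : HasDim (frames B) e)
    (hd : HasDim (chart B R) d) (hne : (chart B R).Nonempty) : e = d + (k + 1) * (k + 1) := by
  obtain ⟨M₀, hM₀⟩ := hne
  apply le_antisymm
  · obtain ⟨Q, hQ, hQM⟩ := hd.exists_finrank_eq
    obtain ⟨M, hM, hMQ⟩ := exists_eval_ne_zero hQ
    rw [← hQM M hM hMQ, ← finrank_tangentSpace_chart hM]
    exact he.le_finrank hM.1
  · obtain ⟨Q, hQ, hQM⟩ := he.exists_finrank_eq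
    have hdet : chartDet R ∉ vanishingIdeal K (frames B) := fun h =>
      det_mul_ne_zero_of_mem_chart hM₀ ((eval_chartDet R M₀).symm.trans (h M₀ hM₀.1))
    obtain ⟨M, hM, hM0⟩ := exists_eval_ne_zero fun h => (he.1.mem_or_mem h).elim hQ hdet
    rw [map_mul, eval_chartDet] at hM0
    have hdetM := right_ne_zero_of_mul hM0
    have hM' := act_inv_mem_chart hM hdetM
    rw [← hQM M hM (left_ne_zero_of_mul hM0), ← finrank_tangentSpace_act B M
      (det_inv_ne_zero hdetM), finrank_tangentSpace_chart hM']
    exact Nat.add_le_add_right (hd.le_finrank hM') _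

theorem hasDim_frames [IsAlgClosed K] [CharZero K] {n : ℕ} (hBclosed : IsClosed B)
    (hBirr : IsIrreducible B) (hBdim : topologicalKrullDim B = (n : WithBot ℕ∞)) :
    HasDim (frames B) (n + (k + 1) * (k + 1)) := by
  obtain ⟨e, he⟩ := exists_hasDim (isPrime_vanishingIdeal_frames hBirr)
  obtain ⟨R, hR⟩ := exists_chart_nonempty hBirr.1
  obtain ⟨d, hd⟩ := exists_hasDim (isPrime_vanishingIdeal_iff.2 (isIrreducible_chart hBirr hR))
  have hed := he.eq_of_chart hd hR
  have hdim : topologicalKrullDim B = d := topologicalKrullDim_eq_of_chart hBirr.1 fun R' hR' => by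
    obtain ⟨d', hd'⟩ :=
      exists_hasDim (isPrime_vanishingIdeal_iff.2 (isIrreducible_chart hBirr hR'))
    have hd'd : d' = d := Nat.add_right_cancel ((he.eq_of_chart hd' hR').symm.trans hed)
    rw [topologicalKrullDim_eq_ringKrullDim (isClosed_chart hBclosed R'), hd'.2, hd'd]
  have hnd : n = d := by exact_mod_cast hBdim.symm.trans hdim
  rwa [hnd, ← hed]

end Charts

section Reindex

variable {K σ τ : Type*} [Field K]

theorem HasDim.of_reindex (f : σ ≃ τ) {C : Set (σ → K)} {d : ℕ}
    (h : HasDim {y : τ → K | y ∘ f ∈ C} d) : HasDim C d := by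
  let e : MvPolynomial σ K ≃+* MvPolynomial τ K := (renameEquiv K f).toRingEquiv
  have hcomap : vanishingIdeal K C = (vanishingIdeal K {y : τ → K | y ∘ f ∈ C}).comap e := by
    ext P
    rw [Ideal.mem_comap]
    refine ⟨fun hP y hy => (aeval_rename f y P).trans (hP _ hy), fun hP x hx => ?_⟩
    have hxf : (x ∘ f.symm) ∘ f = x := by
      rw [Function.comp_assoc, f.symm_comp_self, Function.comp_id]
    rw [← hxf]
    exact (aeval_rename f _ P).symm.trans (hP _ (by rwa [Set.mem_ofPred_eq, hxf]))
  have hprime := h.1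
  refine ⟨hcomap ▸ Ideal.comap_isPrime e _, h.2 ▸ ringKrullDim_eq_of_ringEquiv ?_⟩
  exact Ideal.quotientEquiv _ _ e (hcomap ▸ (Ideal.map_comap_of_surjective _ e.surjective _).symm)

end Reindex

section ProjectiveSpace

variable {K : Type*} [Field K] {N : ℕ}

/-- Points of `ℙ^N` as members of `𝔾(0, N)`. -/
def grEquiv : PSpace K N ≃ Gr K N 0 := Projectivization.equivSubmodule K (Vec K N)

/-- Nonzero vectors as matrices of rank one with one row. -/
def vecHomeomorph : {v : Vec K N // v ≠ 0} ≃ₜ {M : Fin (0 + 1) × Fin (N + 1) → K //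
    LinearIndependent K (fun i j => M (i, j) : Fin (0 + 1) → Vec K N)} where
  toFun v := ⟨fun p => v.1 p.2, (linearIndependent_unique_iff (ι := Fin 1)).2 v.2⟩
  invFun M := ⟨fun j => M.1 (0, j), M.2.ne_zero 0⟩
  left_inv _ := rfl
  right_inv M := Subtype.ext <| funext fun _ =>
    congrArg M.1 (Prod.ext (Subsingleton.elim (α := Fin 1) _ _) rfl)
  continuous_toFun := ((continuous_linearMap (LinearMap.funLeft K K
    (Prod.snd : Fin (0 + 1) × Fin (N + 1) → Fin (N + 1)))).comp
      continuous_subtype_val).subtype_mk _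
  continuous_invFun := ((continuous_linearMap (LinearMap.funLeft K K
    fun j : Fin (N + 1) => ((0 : Fin (0 + 1)), j))).comp continuous_subtype_val).subtype_mk _

theorem grEquiv_mk' (v : {v : Vec K N // v ≠ 0}) :
    grEquiv (Projectivization.mk' K v) = spanGr (vecHomeomorph v) := by
  apply Subtype.ext
  change (Projectivization.mk' K v).submodule = Submodule.span K (Set.range fun _ => v.1)
  rw [Projectivization.mk'_eq_mk, Projectivization.submodule_mk, Set.range_const]

/-- `ℙ^N` is the Grassmannian `𝔾(0, N)`. -/
def grHomeomorph : PSpace K N ≃ₜ Gr K N 0 where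
  toEquiv := grEquiv
  continuous_toFun := by
    rw [continuous_coinduced_dom]
    exact (continuous_coinduced_rng.comp vecHomeomorph.continuous).congr fun v =>
      (grEquiv_mk' v).symm
  continuous_invFun := by
    rw [continuous_coinduced_dom]
    refine (continuous_coinduced_rng.comp vecHomeomorph.symm.continuous).congr fun M => ?_
    exact (grEquiv.symm_apply_eq.2 (by
      rw [Function.comp_apply, grEquiv_mk', vecHomeomorph.apply_symm_apply])).symm

theorem mem_frames_image_grEquiv_iff {X : Set (PSpace K N)} {M : Fin (0 + 1) × Fin (N + 1) → K} :
    M ∈ frames (grEquiv '' X) ↔ (fun j => M (0, j)) ∈ cone X := by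
  rw [mem_frames_iff]
  have hmk (h : LinearIndependent K (rows M).row) :
      spanGr ⟨M, h⟩ = grEquiv (Projectivization.mk K (fun j => M (0, j)) (h.ne_zero 0)) := by
    rw [← vecHomeomorph.apply_symm_apply ⟨M, h⟩, ← grEquiv_mk', Projectivization.mk'_eq_mk]
    rfl
  constructor
  · rintro ⟨h, hM⟩
    rw [hmk h, grEquiv.injective.mem_set_image] at hM
    exact ⟨h.ne_zero 0, hM⟩
  · rintro ⟨h0, hX⟩
    have h : LinearIndependent K (rows M).row := (linearIndependent_unique_iff (ι := Fin 1)).2 h0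
    exact ⟨h, hmk h ▸ Set.mem_image_of_mem _ hX⟩

theorem hasDim_cone [IsAlgClosed K] [CharZero K] {X : Set (PSpace K N)} {m : ℕ}
    (hXclosed : IsClosed X) (hXirr : IsIrreducible X)
    (hXdim : topologicalKrullDim X = (m : WithBot ℕ∞)) : HasDim (cone X) (m + 1) := by
  have hdim : topologicalKrullDim (grEquiv '' X) = (m : WithBot ℕ∞) :=
    ((grHomeomorph.image X).isHomeomorph.topologicalKrullDim_eq _).symm.trans hXdim
  have hframes : HasDim (frames (grEquiv '' X)) (m + (0 + 1) * (0 + 1)) :=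
    hasDim_frames (grHomeomorph.isClosedMap X hXclosed)
      (hXirr.image _ grHomeomorph.continuous.continuousOn) hdim
  refine HasDim.of_reindex (Equiv.uniqueProd (Fin (N + 1)) (Fin 1)).symm ?_
  convert hframes using 1
  ext M
  exact mem_frames_image_grEquiv_iff.symm

end ProjectiveSpace

section IndependentImages

variable {K σ τ : Type*} [Field K]

theorem exists_eval_ne_zero_linearIndependent_row {ι : Type*} [Finite ι] [Finite τ]
    {A : Matrix ι τ (MvPolynomial σ K)} {x₀ : σ → K}
    (hA : LinearIndependent K (A.map (eval x₀)).row) :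
    ∃ q : MvPolynomial σ K, eval x₀ q ≠ 0 ∧
      ∀ x, eval x q ≠ 0 → LinearIndependent K (A.map (eval x)).row := by
  classical
  have := Fintype.ofFinite ι
  have := Fintype.ofFinite τ
  obtain ⟨R, hR⟩ := exists_mul_eq_one_of_linearIndependent_row hA
  let Q : Matrix ι ι (MvPolynomial σ K) := A * (R.map C : Matrix τ ι (MvPolynomial σ K))
  have hQ (x : σ → K) : eval x Q.det = (A.map (eval x) * R).det := by
    rw [RingHom.map_det, RingHom.mapMatrix_apply, Matrix.map_mul]
    simp [Matrix.map_map, Function.comp_def]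
  refine ⟨Q.det, by rw [hQ, hR, det_one]; exact one_ne_zero, fun x hx => ?_⟩
  exact linearIndependent_row_of_det_mul_ne_zero (hQ x ▸ hx)

theorem HasDim.exists_linearIndependent_near [CharZero K] {ι : Type*} [Finite ι]
    [Fintype σ] [Finite τ] {C : Set (σ → K)} {e : ℕ} (hC : HasDim C e) {x₀ : σ → K}
    (hfin : Module.finrank K (tangentSpace C x₀) = e)
    (f : ι → (σ → K) →ₗ[K] (τ → K)) (w : ι → σ → K) (hw : ∀ a, w a ∈ tangentSpace C x₀)
    (hli : LinearIndependent K fun a => f a (w a)) :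
    ∃ q : MvPolynomial σ K, eval x₀ q ≠ 0 ∧ ∀ x ∈ C, eval x q ≠ 0 →
      Module.finrank K (tangentSpace C x) = e ∧
        ∃ w' : ι → σ → K, (∀ a, w' a ∈ tangentSpace C x) ∧
          LinearIndependent K fun a => f a (w' a) := by
  have := Fintype.ofFinite τ
  obtain ⟨D, hD, hle, hext⟩ := exists_local_extension C x₀
  choose W hW₀ hW using fun a => hext (w a) (hw a)
  let A : Matrix ι τ (MvPolynomial σ K) := of fun a j => bind₁ (W a) (linearPoly (f a) j)
  have hA (x : σ → K) (a : ι) : (A.map (eval x)).row a = f a (eval x ∘ W a) := by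
    rw [← eval_linearPoly]
    exact funext fun j => aeval_bind₁ x (W a) _
  have hA₀ : (A.map (eval x₀)).row = fun a => f a (w a) :=
    funext fun a => by rw [hA, hW₀]
  obtain ⟨q, hq₀, hq⟩ := exists_eval_ne_zero_linearIndependent_row (hA₀ ▸ hli)
  refine ⟨D * q, by rw [map_mul]; exact mul_ne_zero hD hq₀, fun x hx hDq => ?_⟩
  rw [map_mul] at hDq
  have hDx := left_ne_zero_of_mul hDq
  have hfx : Module.finrank K (tangentSpace C x) = e :=
    ((hle x hDx).trans hfin.le).antisymm (hC.le_finrank hx)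
  refine ⟨hfx, fun a => eval x ∘ W a, fun a => hW a x hDx (by rw [hfin, hfx]), ?_⟩
  exact (funext (hA x)) ▸ hq x (right_ne_zero_of_mul hDq)

end IndependentImages

theorem submodule_eq_top_of_eval_ne_zero {K ι : Type*} [Field K] [Infinite K] [Finite ι]
    {P : MvPolynomial ι K} (hP : P ≠ 0) {S : Submodule K (ι → K)}
    (hS : ∀ t, eval t P ≠ 0 → t ∈ S) : S = ⊤ := by
  have := Fintype.ofFinite ι
  by_contra hne
  obtain ⟨f, hf, hSf⟩ := Submodule.exists_le_ker_of_lt_top S (lt_top_iff_ne_top.2 hne)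
  let ℓ : MvPolynomial ι K := linearPoly (LinearMap.pi fun _ : Unit => f) ()
  have hℓ (t : ι → K) : eval t ℓ = f t := congrFun (eval_linearPoly _ t) ()
  have hℓ0 : ℓ ∈ vanishingIdeal K {t | eval t P ≠ 0} := fun t ht => (hℓ t).trans (hSf (hS t ht))
  rw [vanishingIdeal_eval_ne_zero hP, Ideal.mem_bot] at hℓ0
  exact hf (LinearMap.ext fun t => by rw [← hℓ, hℓ0, map_zero, LinearMap.zero_apply])

section Cone

variable {K : Type*} [Field K] {N : ℕ} {X : Set (PSpace K N)}

theorem smul_mem_cone {v : Vec K N} (hv : v ∈ cone X) {c : K} (hc : c ≠ 0) : c • v ∈ cone X := by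
  obtain ⟨h, hX⟩ := hv
  refine ⟨smul_ne_zero hc h, ?_⟩
  rwa [(Projectivization.mk_eq_mk_iff' K (c • v) v (smul_ne_zero hc h) h).2 ⟨c, rfl⟩]

theorem tangentSpace_cone_smul (v : Vec K N) {c : K} (hc : c ≠ 0) :
    tangentSpace (cone X) (c • v) = tangentSpace (cone X) v := by
  have hle (v : Vec K N) {c : K} (hc : c ≠ 0) :
      tangentSpace (cone X) v ≤ tangentSpace (cone X) (c • v) := by
    intro w hw
    have hcw := map_mem_tangentSpace (f := (c • LinearMap.id : Vec K N →ₗ[K] Vec K N))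
      (D := cone X) (fun x hx => smul_mem_cone hx hc) hw
    exact ((tangentSpace (cone X) (c • v)).smul_mem_iff hc).1 hcw
  refine le_antisymm ?_ (hle v hc)
  simpa only [inv_smul_smul₀ hc] using hle (c • v) (inv_ne_zero hc)

theorem embeddedTangentSpace_mk (X : Set (PSpace K N)) (v : Vec K N) (hv : v ≠ 0) :
    embeddedTangentSpace X (Projectivization.mk K v hv) = tangentSpace (cone X) v := by
  obtain ⟨a, ha⟩ := Projectivization.exists_smul_eq_mk_rep K v hv
  rw [embeddedTangentSpace, ← ha]
  exact tangentSpace_cone_smul v a.ne_zero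

theorem mem_cone_unionOf {k : ℕ} {B : Set (Gr K N k)} {v : Vec K N} :
    v ∈ cone (unionOf B) ↔ v ≠ 0 ∧ ∃ L ∈ B, v ∈ L.toSub := by
  simp only [cone, unionOf, Set.mem_ofPred_eq, Projectivization.submodule_mk,
    Submodule.span_singleton_le_iff_mem, exists_prop]

end Cone

section RowComb

variable {K ι κ : Type*} [Field K] [Fintype ι]

/-- The combination of the rows of a matrix with given coefficients. -/
def rowComb : (ι → K) →ₗ[K] (ι × κ → K) →ₗ[K] (κ → K) :=
  LinearMap.mk₂ K (fun t M => t ᵥ* rows M)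
    (fun s t M => Matrix.add_vecMul (rows M) s t)
    (fun c t M => Matrix.smul_vecMul c t (rows M))
    (fun t M M' => by rw [map_add, Matrix.vecMul_add])
    (fun c t M => by rw [map_smul, Matrix.vecMul_smul])

theorem rowComb_act (t : ι → K) (g : Matrix ι ι K) (M : ι × κ → K) :
    rowComb t (act g M) = rowComb (t ᵥ* g) M :=
  (Matrix.vecMul_vecMul t g (rows M)).symm

theorem rowComb_apply (t : ι → K) (M : ι × κ → K) :
    rowComb t M = ∑ i, t i • fun j => M (i, j) :=
  Matrix.vecMul_eq_sum t (rows M)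

theorem rowComb_single [DecidableEq ι] (i : ι) (M : ι × κ → K) :
    rowComb (Pi.single i 1) M = fun j => M (i, j) :=
  Matrix.single_one_vecMul i (rows M)

theorem exists_vecMul_eq {t : ι → K} (ht : t ≠ 0) (s : κ → K) :
    ∃ g : Matrix ι κ K, t ᵥ* g = s := by
  classical
  obtain ⟨i, hi⟩ := Function.ne_iff.1 ht
  refine ⟨Matrix.vecMulVec (Pi.single i (t i)⁻¹) s, ?_⟩
  rw [Matrix.vecMul_vecMulVec, dotProduct_single, mul_inv_cancel₀ hi, one_smul]

end RowComb

theorem finrank_comap_mkQ {K V : Type*} [Field K] [AddCommGroup V] [Module K V]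
    [FiniteDimensional K V] (L : Submodule K V) (S : Submodule K (V ⧸ L)) :
    Module.finrank K (S.comap L.mkQ) = Module.finrank K S + Module.finrank K L := by
  have h1 := LinearMap.finrank_range_add_finrank_ker (L.mkQ.domRestrict (S.comap L.mkQ))
  rw [LinearMap.range_domRestrict, Submodule.map_comap_eq_of_surjective L.mkQ_surjective] at h1
  rw [← h1, LinearMap.ker_domRestrict, Submodule.ker_mkQ,
    (Submodule.comapSubtypeEquivOfLe (Submodule.le_comap_mkQ L S)).finrank_eq]

/-! ### The characteristic map in coordinates -/

section TangentGr

variable {K : Type*} [Field K] {N k : ℕ} {L : Gr K N k}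

/-- The frame of `Λ` given by a basis of `Λ̂`, as a point of the affine space of matrices. -/
def basisFrame (b : Module.Basis (Fin (k + 1)) K L.toSub) : Fin (k + 1) × Fin (N + 1) → K :=
  fun p => (b p.1 : Vec K N) p.2

theorem basisFrame_mem_singleton (b : Module.Basis (Fin (k + 1)) K L.toSub) :
    basisFrame b ∈ frames {L} :=
  ⟨L, rfl, b, fun _ _ => rfl⟩

theorem basisFrame_mem {B : Set (Gr K N k)} (hL : L ∈ B)
    (b : Module.Basis (Fin (k + 1)) K L.toSub) : basisFrame b ∈ frames B :=
  ⟨L, hL, b, fun _ _ => rfl⟩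

theorem exists_eq_basisFrame {M : Fin (k + 1) × Fin (N + 1) → K} (hM : M ∈ frames {L}) :
    ∃ b : Module.Basis (Fin (k + 1)) K L.toSub, M = basisFrame b := by
  obtain ⟨_, rfl, b, hb⟩ := hM
  exact ⟨b, funext fun p => hb p.1 p.2⟩

theorem rowComb_basisFrame (b : Module.Basis (Fin (k + 1)) K L.toSub) (t : Fin (k + 1) → K) :
    rowComb t (basisFrame b) = (b.equivFun.symm t : Vec K N) := by
  rw [rowComb_apply, Module.Basis.equivFun_symm_apply, Submodule.coe_sum]
  rfl

theorem rowComb_equivFun_basisFrame (b : Module.Basis (Fin (k + 1)) K L.toSub) (v : L.toSub) :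
    rowComb (b.equivFun v) (basisFrame b) = (v : Vec K N) := by
  rw [rowComb_basisFrame, LinearEquiv.symm_apply_apply]

theorem equivFun_basis (b : Module.Basis (Fin (k + 1)) K L.toSub) (i : Fin (k + 1)) :
    b.equivFun (b i) = Pi.single i 1 := by
  rw [b.equivFun_apply, b.repr_self, Finsupp.single_eq_pi_single]

/-- The differential, at the frame given by `b`, of the quotient map from frames to the
Grassmannian. -/
def frameHom (b : Module.Basis (Fin (k + 1)) K L.toSub) :
    (Fin (k + 1) × Fin (N + 1) → K) →ₗ[K] (L.toSub →ₗ[K] (Vec K N ⧸ L.toSub)) where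
  toFun w := L.toSub.mkQ ∘ₗ rowComb.flip w ∘ₗ b.equivFun.toLinearMap
  map_add' _ _ := by rw [map_add, LinearMap.add_comp, LinearMap.comp_add]
  map_smul' _ _ := by rw [map_smul, LinearMap.smul_comp, LinearMap.comp_smul, RingHom.id_apply]

theorem frameHom_apply (b : Module.Basis (Fin (k + 1)) K L.toSub)
    (w : Fin (k + 1) × Fin (N + 1) → K) (v : L.toSub) :
    frameHom b w v = L.toSub.mkQ (rowComb (b.equivFun v) w) := rfl

theorem frameHom_basis (b : Module.Basis (Fin (k + 1)) K L.toSub)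
    (w : Fin (k + 1) × Fin (N + 1) → K) (i : Fin (k + 1)) :
    frameHom b w (b i) = Submodule.Quotient.mk fun j => w (i, j) := by
  rw [frameHom_apply, equivFun_basis, rowComb_single]
  rfl

theorem frameHom_eq_zero_iff (b : Module.Basis (Fin (k + 1)) K L.toSub)
    (w : Fin (k + 1) × Fin (N + 1) → K) :
    frameHom b w = 0 ↔ ∃ g : Matrix (Fin (k + 1)) (Fin (k + 1)) K, act g (basisFrame b) = w := by
  constructor
  · intro h
    have hmem (i : Fin (k + 1)) : (fun j => w (i, j)) ∈ L.toSub := by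
      rw [← Submodule.Quotient.mk_eq_zero, ← frameHom_basis b, h, LinearMap.zero_apply]
    refine ⟨Matrix.of fun i => b.equivFun ⟨_, hmem i⟩, funext fun p => ?_⟩
    exact congrFun (rowComb_equivFun_basisFrame b ⟨_, hmem p.1⟩) p.2
  · rintro ⟨g, rfl⟩
    ext v
    rw [frameHom_apply, rowComb_act, rowComb_basisFrame, LinearMap.zero_apply,
      Submodule.mkQ_apply, Submodule.Quotient.mk_eq_zero]
    exact Subtype.coe_prop _

theorem frameHom_act {b b' : Module.Basis (Fin (k + 1)) K L.toSub}
    {g : Matrix (Fin (k + 1)) (Fin (k + 1)) K} (hg : act g (basisFrame b) = basisFrame b')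
    (w : Fin (k + 1) × Fin (N + 1) → K) : frameHom b' (act g w) = frameHom b w := by
  ext v
  rw [frameHom_apply, frameHom_apply, rowComb_act]
  congr 3
  apply b.equivFun.symm.injective
  apply Subtype.ext
  rw [← rowComb_basisFrame, ← rowComb_act, hg, rowComb_equivFun_basisFrame,
    LinearEquiv.symm_apply_apply]

variable {B : Set (Gr K N k)}

theorem mem_tangentSpaceGr_iff (b : Module.Basis (Fin (k + 1)) K L.toSub)
    (η : L.toSub →ₗ[K] (Vec K N ⧸ L.toSub)) :
    η ∈ tangentSpaceGr B L ↔ ∃ w ∈ tangentSpace (frames B) (basisFrame b), frameHom b w = η := by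
  constructor
  · intro h
    obtain ⟨w, hw, h1⟩ := h b
    exact ⟨w, hw, b.ext fun i => by rw [frameHom_basis, h1]⟩
  · rintro ⟨w, hw, rfl⟩ b'
    obtain ⟨g, hg, hb'⟩ := exists_act_eq (basisFrame_mem_singleton b) (basisFrame_mem_singleton b')
    refine ⟨act g w, ?_, fun i => ?_⟩
    · change act g w ∈ tangentSpace (frames B) (basisFrame b')
      rw [← hb']
      exact act_mem_tangentSpace_act B hg hw
    · rw [← frameHom_act hb', frameHom_basis]

theorem tangentSpaceGr_eq_map (b : Module.Basis (Fin (k + 1)) K L.toSub) :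
    tangentSpaceGr B L = (tangentSpace (frames B) (basisFrame b)).map (frameHom b) := by
  ext η
  rw [mem_tangentSpaceGr_iff b, Submodule.mem_map]

theorem finrank_ker_frameHom (b : Module.Basis (Fin (k + 1)) K L.toSub) :
    Module.finrank K (LinearMap.ker (frameHom b)) = (k + 1) * (k + 1) := by
  let T : Matrix (Fin (k + 1)) (Fin (k + 1)) K →ₗ[K] (Fin (k + 1) × Fin (N + 1) → K) :=
    act.flip (basisFrame b)
  have hT : Function.Injective T := fun g g' h => funext fun i =>
    Matrix.vecMul_injective_iff.2 (mem_frames_iff.1 (basisFrame_mem_singleton b)).1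
      (congrFun (congrArg rows h) i)
  have hker : LinearMap.ker (frameHom b) = LinearMap.range T := by
    ext w
    rw [LinearMap.mem_ker, frameHom_eq_zero_iff]
    rfl
  rw [hker, LinearMap.finrank_range_of_inj hT, Module.finrank_matrix, Module.finrank_self,
    Fintype.card_fin, mul_one]

theorem finrank_tangentSpace_basisFrame [Infinite K] (hL : L ∈ B)
    (b : Module.Basis (Fin (k + 1)) K L.toSub) :
    Module.finrank K (tangentSpace (frames B) (basisFrame b))
      = Module.finrank K (tangentSpaceGr B L) + (k + 1) * (k + 1) := by
  have hle : LinearMap.ker (frameHom b) ≤ tangentSpace (frames B) (basisFrame b) := by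
    intro w hw
    obtain ⟨g, rfl⟩ := (frameHom_eq_zero_iff b w).1 hw
    exact act_mem_tangentSpace (basisFrame_mem hL b) g
  have h1 := LinearMap.finrank_range_add_finrank_ker
    ((frameHom b).domRestrict (tangentSpace (frames B) (basisFrame b)))
  rw [LinearMap.range_domRestrict, ← tangentSpaceGr_eq_map, LinearMap.ker_domRestrict,
    (Submodule.comapSubtypeEquivOfLe hle).finrank_eq, finrank_ker_frameHom] at h1
  exact h1.symm

/-- The preimage in `V` of the image of the characteristic map at `v`: the span of `Λ` and of the
infinitely near members of the family along `v`. -/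
def tangentHull (B : Set (Gr K N k)) (L : Gr K N k) (v : L.toSub) : Submodule K (Vec K N) :=
  (LinearMap.range (characteristicMap B L v)).comap L.toSub.mkQ

theorem finrank_tangentHull (v : L.toSub) : Module.finrank K (tangentHull B L v)
    = Module.finrank K (LinearMap.range (characteristicMap B L v)) + (k + 1) := by
  rw [tangentHull, finrank_comap_mkQ]
  congr 1
  exact L.2

theorem mem_tangentHull_iff [Infinite K] (hL : L ∈ B) (b : Module.Basis (Fin (k + 1)) K L.toSub)
    {v : L.toSub} (hv : v ≠ 0) (x : Vec K N) :
    x ∈ tangentHull B L v ↔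
      ∃ w ∈ tangentSpace (frames B) (basisFrame b), rowComb (b.equivFun v) w = x := by
  constructor
  · rintro ⟨⟨η, hη⟩, hx⟩
    obtain ⟨w, hw, rfl⟩ := (mem_tangentSpaceGr_iff b η).1 hη
    change frameHom b w v = L.toSub.mkQ x at hx
    rw [frameHom_apply, eq_comm, ← sub_eq_zero, ← map_sub, Submodule.mkQ_apply,
      Submodule.Quotient.mk_eq_zero] at hx
    obtain ⟨g, hg⟩ := exists_vecMul_eq (t := b.equivFun v)
      (fun h => hv (b.equivFun.map_eq_zero_iff.1 h)) (b.equivFun ⟨_, hx⟩)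
    refine ⟨w + act g (basisFrame b),
      Submodule.add_mem _ hw (act_mem_tangentSpace (basisFrame_mem hL b) g), ?_⟩
    rw [map_add, rowComb_act, hg, rowComb_equivFun_basisFrame, add_sub_cancel]
  · rintro ⟨w, hw, rfl⟩
    refine ⟨⟨frameHom b w, (mem_tangentSpaceGr_iff b _).2 ⟨w, hw, rfl⟩⟩, ?_⟩
    change frameHom b w v = _
    rw [frameHom_apply]

theorem rowComb_mem_cone {t : Fin (k + 1) → K} (ht : t ≠ 0) {M : Fin (k + 1) × Fin (N + 1) → K}
    (hM : M ∈ frames B) : rowComb t M ∈ cone (unionOf B) := by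
  obtain ⟨L, hL, hM⟩ := mem_frames_iff_exists_singleton.1 hM
  obtain ⟨b, rfl⟩ := exists_eq_basisFrame hM
  rw [rowComb_basisFrame, mem_cone_unionOf]
  refine ⟨fun h => ht ?_, L, hL, Subtype.coe_prop _⟩
  exact b.equivFun.symm.map_eq_zero_iff.1 (Subtype.ext h)

theorem tangentHull_le [Infinite K] (hL : L ∈ B) {v : L.toSub} (hv : v ≠ 0) :
    tangentHull B L v ≤ tangentSpace (cone (unionOf B)) (v : Vec K N) := by
  let b := Module.finBasisOfFinrankEq K L.toSub L.2
  intro x hx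
  obtain ⟨w, hw, rfl⟩ := (mem_tangentHull_iff hL b hv x).1 hx
  have ht : b.equivFun v ≠ 0 := fun h => hv (b.equivFun.map_eq_zero_iff.1 h)
  have := map_mem_tangentSpace (f := rowComb (b.equivFun v)) (D := cone (unionOf B))
    (fun M hM => rowComb_mem_cone ht hM) hw
  rwa [rowComb_equivFun_basisFrame] at this

end TangentGr
/-! ### Ruled varieties -/

theorem card_le_finrank_of_forall_mem {K V ι : Type*} [Field K] [AddCommGroup V]
    [Module K V] [FiniteDimensional K V] [Fintype ι] {x : ι → V} (hx : LinearIndependent K x)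
    {S : Submodule K V} (hS : ∀ i, x i ∈ S) : Fintype.card ι ≤ Module.finrank K S := by
  rw [← finrank_span_eq_card hx]
  exact Submodule.finrank_mono (Submodule.span_le.2 (Set.range_subset_iff.2 hS))

section RuledFamily

variable {K : Type*} [Field K] {N k n : ℕ} {B : Set (Gr K N k)} {L : Gr K N k}

theorem not_allFocal_iff : ¬ AllFocal B L ↔ ∃ v : L.toSub, v ≠ 0 ∧ ¬ IsFocalAt B L v := by
  simp only [AllFocal, not_forall, exists_prop]

theorem bind₁_rowComb_mem_vanishingIdeal_frames_iff [Infinite K] {t : Fin (k + 1) → K} (ht : t ≠ 0)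
    (Q : MvPolynomial (Fin (N + 1)) K) :
    bind₁ (linearPoly (rowComb t)) Q ∈ vanishingIdeal K (frames B) ↔
      Q ∈ vanishingIdeal K (cone (unionOf B)) := by
  constructor
  · intro hQ v hv
    obtain ⟨-, L, hL, hvL⟩ := mem_cone_unionOf.1 hv
    let b := Module.finBasisOfFinrankEq K L.toSub L.2
    let f : (Fin (k + 1) × Fin (k + 1) → K) →ₗ[K] Vec K N := rowComb t ∘ₗ orbitMap (basisFrame b)
    have hf (g : Fin (k + 1) × Fin (k + 1) → K) :
        eval g (bind₁ (linearPoly f) Q) = eval (rowComb t (act (rows g) (basisFrame b))) Q :=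
      eval_bind₁_linearPoly f g Q
    have hfQ : bind₁ (linearPoly f) Q = 0 := by
      rw [← Ideal.mem_bot, ← vanishingIdeal_det_ne_zero]
      intro g hg
      have hgQ : eval (act (rows g) (basisFrame b)) (bind₁ (linearPoly (rowComb t)) Q) = 0 :=
        hQ _ (act_mem_frames (basisFrame_mem hL b) hg)
      rw [eval_bind₁_linearPoly] at hgQ
      exact (hf g).trans hgQ
    obtain ⟨g, hg⟩ := exists_vecMul_eq ht (b.equivFun ⟨v, hvL⟩)
    have hgv := hf (rows.symm g)
    rw [hfQ, map_zero, LinearEquiv.apply_symm_apply, rowComb_act, hg,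
      rowComb_equivFun_basisFrame] at hgv
    exact hgv.symm
  · intro hQ M hM
    exact (eval_bind₁_linearPoly (rowComb t) M Q).trans (hQ _ (rowComb_mem_cone ht hM))

/-- The standing assumptions on an `n`-dimensional family of `k`-spaces whose union has dimension
`n + k < N`; the dimensions are also recorded for the affine sets of frames and of the cone. -/
structure IsRuledFamily (B : Set (Gr K N k)) (n : ℕ) : Prop where
  dim_eq : topologicalKrullDim B = (n : WithBot ℕ∞)
  dim_union : topologicalKrullDim (unionOf B) = ((n + k : ℕ) : WithBot ℕ∞)
  irreducible : IsIrreducible B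
  hasDim_frames : HasDim (frames B) (n + (k + 1) * (k + 1))
  hasDim_cone : HasDim (cone (unionOf B)) (n + k + 1)
  lt : n + k < N

namespace IsRuledFamily

variable (h : IsRuledFamily B n)
include h

theorem isSmoothMember_iff :
    IsSmoothMember B L ↔ L ∈ B ∧ Module.finrank K (tangentSpaceGr B L) = n := by
  rw [IsSmoothMember, h.dim_eq]
  norm_cast

theorem isSmoothMember_iff_frame [Infinite K] (hL : L ∈ B)
    (b : Module.Basis (Fin (k + 1)) K L.toSub) : IsSmoothMember B L ↔
      Module.finrank K (tangentSpace (frames B) (basisFrame b)) = n + (k + 1) * (k + 1) := by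
  rw [h.isSmoothMember_iff, finrank_tangentSpace_basisFrame hL, add_left_inj]
  exact and_iff_right hL

theorem maxRank_eq (hL : IsSmoothMember B L) : maxRank B L = n := by
  have hquot := Submodule.finrank_quotient_add_finrank L.toSub
  rw [show Module.finrank K L.toSub = k + 1 from L.2, Module.finrank_fin_fun] at hquot
  rw [maxRank, (h.isSmoothMember_iff.1 hL).2]
  have := h.lt
  omega

theorem finrank_tangentHull_le (hL : IsSmoothMember B L) (v : L.toSub) :
    Module.finrank K (tangentHull B L v) ≤ n + k + 1 := by
  rw [finrank_tangentHull, ← (h.isSmoothMember_iff.1 hL).2, add_assoc]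
  exact Nat.add_le_add_right (LinearMap.finrank_range_le _) _

theorem not_isFocalAt_iff_le (hL : IsSmoothMember B L) (v : L.toSub) :
    ¬ IsFocalAt B L v ↔ n + k + 1 ≤ Module.finrank K (tangentHull B L v) := by
  rw [IsFocalAt, h.maxRank_eq hL, finrank_tangentHull]
  omega

theorem not_isFocalAt_iff (hL : IsSmoothMember B L) (v : L.toSub) :
    ¬ IsFocalAt B L v ↔ Module.finrank K (tangentHull B L v) = n + k + 1 := by
  rw [h.not_isFocalAt_iff_le hL]
  exact ⟨(h.finrank_tangentHull_le hL v).antisymm, fun h => h.ge⟩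

theorem isSmoothPoint_mk_iff (v : Vec K N) (hv : v ≠ 0) :
    IsSmoothPoint (unionOf B) (Projectivization.mk K v hv) ↔ v ∈ cone (unionOf B) ∧
      Module.finrank K (tangentSpace (cone (unionOf B)) v) = n + k + 1 := by
  have hcone : v ∈ cone (unionOf B) ↔ Projectivization.mk K v hv ∈ unionOf B :=
    ⟨fun h => h.2, fun h => ⟨hv, h⟩⟩
  rw [IsSmoothPoint, embeddedTangentSpace_mk, h.dim_union, hcone]
  norm_cast

theorem not_allFocal_of_linearIndependent_rowComb [Infinite K] (hL : IsSmoothMember B L)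
    (b : Module.Basis (Fin (k + 1)) K L.toSub) {t : Fin (k + 1) → K} (ht : t ≠ 0)
    {w : Fin (n + k + 1) → Fin (k + 1) × Fin (N + 1) → K}
    (hw : ∀ a, w a ∈ tangentSpace (frames B) (basisFrame b))
    (hli : LinearIndependent K fun a => rowComb t (w a)) : ¬ AllFocal B L := by
  have hv : b.equivFun.symm t ≠ 0 := b.equivFun.symm.map_ne_zero_iff.2 ht
  refine fun hall => (h.not_isFocalAt_iff_le hL _).2 ?_ (hall _ hv)
  rw [← Fintype.card_fin (n + k + 1)]
  refine card_le_finrank_of_forall_mem hli fun a => ?_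
  exact (mem_tangentHull_iff hL.1 b hv _).2 ⟨w a, hw a, by rw [LinearEquiv.apply_symm_apply]⟩

variable [CharZero K]

theorem exists_not_allFocal : ∃ L, IsSmoothMember B L ∧ ¬ AllFocal B L := by
  let t : Fin (k + 1) → K := Pi.single 0 1
  have ht : t ≠ 0 := Pi.single_ne_zero_iff.2 one_ne_zero
  obtain ⟨Q₁, hQ₁, hfin⟩ := h.hasDim_frames.exists_finrank_eq
  -- Generic smoothness of the dominant map sending a frame to a combination of its rows.
  obtain ⟨Q₂, hQ₂, hsub⟩ := h.hasDim_cone.exists_linearIndependent_diffMap h.hasDim_frames.1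
    (linearPoly (rowComb t)) fun Q => (bind₁_rowComb_mem_vanishingIdeal_frames_iff ht Q).symm
  obtain ⟨M, hM, hQ⟩ := exists_eval_ne_zero (C := frames B) (P := Q₁ * Q₂)
    fun hmem => (h.hasDim_frames.1.mem_or_mem hmem).elim hQ₁ hQ₂
  rw [map_mul] at hQ
  obtain ⟨W, hW, hli⟩ := hsub M hM (right_ne_zero_of_mul hQ)
  have hfinM := hfin M hM (left_ne_zero_of_mul hQ)
  obtain ⟨L, hL, hML⟩ := mem_frames_iff_exists_singleton.1 hM
  obtain ⟨b, rfl⟩ := exists_eq_basisFrame hML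
  have hsm := (h.isSmoothMember_iff_frame hL b).2 hfinM
  refine ⟨L, hsm, h.not_allFocal_of_linearIndependent_rowComb hsm b ht hW ?_⟩
  simpa only [diffMap_linearPoly] using hli

theorem exists_isOpen_linearIndependent (hL : IsSmoothMember B L)
    (b : Module.Basis (Fin (k + 1)) K L.toSub) {m : ℕ} (t : Fin m → Fin (k + 1) → K)
    (w : Fin m → Fin (k + 1) × Fin (N + 1) → K)
    (hw : ∀ a, w a ∈ tangentSpace (frames B) (basisFrame b))
    (hli : LinearIndependent K fun a => rowComb (t a) (w a)) :
    ∃ O : Set (Gr K N k), IsOpen O ∧ L ∈ O ∧ ∀ L' ∈ O, L' ∈ B → IsSmoothMember B L' ∧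
      ∃ (b' : Module.Basis (Fin (k + 1)) K L'.toSub)
        (w' : Fin m → Fin (k + 1) × Fin (N + 1) → K),
        (∀ a, w' a ∈ tangentSpace (frames B) (basisFrame b')) ∧
        LinearIndependent K fun a => rowComb (t a) (w' a) := by
  obtain ⟨q, hq, hq'⟩ := h.hasDim_frames.exists_linearIndependent_near
    ((h.isSmoothMember_iff_frame hL.1 b).1 hL) (fun a => rowComb (t a)) w hw hli
  refine ⟨_, isOpen_exists_frame q, ⟨_, basisFrame_mem_singleton b, hq⟩, ?_⟩
  rintro L' ⟨M, hM, hqM⟩ hL'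
  obtain ⟨b', rfl⟩ := exists_eq_basisFrame hM
  obtain ⟨hfin, hnear⟩ := hq' _ (basisFrame_mem hL' b') hqM
  exact ⟨(h.isSmoothMember_iff_frame hL' b').2 hfin, b', hnear⟩

theorem exists_isOpen_not_allFocal (hL : IsSmoothMember B L) (hf : ¬ AllFocal B L) :
    ∃ O : Set (Gr K N k), IsOpen O ∧ L ∈ O ∧ ∀ L' ∈ O, L' ∈ B →
      IsSmoothMember B L' ∧ ¬ AllFocal B L' := by
  obtain ⟨v, hv, hf⟩ := not_allFocal_iff.1 hf
  rw [h.not_isFocalAt_iff hL] at hf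
  let b := Module.finBasisOfFinrankEq K L.toSub L.2
  let e := Module.finBasisOfFinrankEq K (tangentHull B L v) hf
  choose w hw hwe using fun a => (mem_tangentHull_iff hL.1 b hv _).1 (e a).2
  have hli : LinearIndependent K fun a => rowComb (b.equivFun v) (w a) := by
    simp only [hwe]
    exact e.linearIndependent.map' (Submodule.subtype _) (Submodule.ker_subtype _)
  obtain ⟨O, hO, hLO, hO'⟩ :=
    h.exists_isOpen_linearIndependent hL b (fun _ => b.equivFun v) w hw hli
  refine ⟨O, hO, hLO, fun L' hL'O hL' => ?_⟩
  obtain ⟨hsm, b', w', hw', hli'⟩ := hO' L' hL'O hL'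
  exact ⟨hsm, h.not_allFocal_of_linearIndependent_rowComb hsm b'
    (b.equivFun.map_ne_zero_iff.2 hv) hw' hli'⟩

theorem exists_eval_ne_zero_of_smooth {v : Vec K N}
    (hfin : Module.finrank K (tangentSpace (cone (unionOf B)) v) = n + k + 1) :
    ∃ q : MvPolynomial (Fin (N + 1)) K, eval v q ≠ 0 ∧ ∀ x ∈ cone (unionOf B), eval x q ≠ 0 →
      Module.finrank K (tangentSpace (cone (unionOf B)) x) = n + k + 1 := by
  obtain ⟨q, hq, hq'⟩ := h.hasDim_cone.exists_linearIndependent_near (ι := Empty) (τ := Empty)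
    hfin (fun _ => 0) (fun _ => 0) nofun linearIndependent_empty_type
  exact ⟨q, hq, fun x hx hx0 => (hq' x hx hx0).1⟩

theorem exists_isOpen_exists_smooth : ∃ O : Set (Gr K N k), IsOpen O ∧ (B ∩ O).Nonempty ∧
    ∀ L ∈ O, L ∈ B →
      ∃ x : PSpace K N, x.submodule ≤ L.toSub ∧ IsSmoothPoint (unionOf B) x := by
  obtain ⟨Q, hQ, hfin⟩ := h.hasDim_cone.exists_finrank_eq
  obtain ⟨v, hv, hQv⟩ := exists_eval_ne_zero hQ
  obtain ⟨hv0, L, hL, hvL⟩ := mem_cone_unionOf.1 hv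
  let b := Module.finBasisOfFinrankEq K L.toSub L.2
  let t := b.equivFun ⟨v, hvL⟩
  have ht : t ≠ 0 := b.equivFun.map_ne_zero_iff.2 fun h0 => hv0 (congrArg Subtype.val h0)
  refine ⟨_, isOpen_exists_frame (bind₁ (linearPoly (rowComb t)) Q),
    ⟨L, hL, _, basisFrame_mem_singleton b, ?_⟩, ?_⟩
  · rw [eval_bind₁_linearPoly, rowComb_equivFun_basisFrame]
    exact hQv
  · rintro L' ⟨M, hM, hqM⟩ hL'
    rw [eval_bind₁_linearPoly] at hqM
    have hcone := rowComb_mem_cone ht (mem_frames_iff_exists_singleton.2 ⟨L', hL', hM⟩)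
    obtain ⟨b', rfl⟩ := exists_eq_basisFrame hM
    refine ⟨Projectivization.mk K _ hcone.1, ?_,
      (h.isSmoothPoint_mk_iff _ _).2 ⟨hcone, hfin _ hcone hqM⟩⟩
    rw [Projectivization.submodule_mk, Submodule.span_singleton_le_iff_mem, rowComb_basisFrame]
    exact Subtype.coe_prop _

end IsRuledFamily

end RuledFamily

theorem mem_tangentSpace_of_eval_ne_zero {K σ τ : Type*} [Field K] [Infinite K] [Finite σ]
    [Fintype τ] {C : Set (τ → K)} {u : τ → K} (f : (σ → K) →ₗ[K] (τ → K)) {Δ : MvPolynomial σ K}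
    (hΔ : Δ ≠ 0) (h : ∀ t, eval t Δ ≠ 0 → u ∈ tangentSpace C (f t)) (t : σ → K) :
    u ∈ tangentSpace C (f t) := by
  have := Fintype.ofFinite σ
  intro P hP
  let dP : MvPolynomial τ K := ∑ j, pderiv j P * MvPolynomial.C (u j)
  have hdP (s : σ → K) :
      eval s (bind₁ (linearPoly f) dP) = ∑ j, eval (f s) (pderiv j P) * u j := by
    simp [eval_bind₁_linearPoly, dP]
  have hzero : bind₁ (linearPoly f) dP = 0 := by
    rw [← Ideal.mem_bot, ← vanishingIdeal_eval_ne_zero hΔ]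
    exact fun s hs => (hdP s).trans (h s hs P hP)
  rw [← hdP, hzero, map_zero]

theorem linearIndependent_finCons_basis {K V : Type*} [Field K] [AddCommGroup V] [Module K V]
    {S : Submodule K V} {m : ℕ} (e : Module.Basis (Fin m) K S) {x : V} (hx : x ∉ S) :
    LinearIndependent K (Fin.cons x fun a => (e a : V) : Fin (m + 1) → V) := by
  have hspan : Submodule.span K (Set.range fun a => (e a : V)) ≤ S :=
    Submodule.span_le.2 (Set.range_subset_iff.2 fun a => (e a).2)
  rw [linearIndependent_finCons]
  exact ⟨e.linearIndependent.map' S.subtype S.ker_subtype, fun hmem => hx (hspan hmem)⟩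

theorem exists_basis_dual_repr_eq {K V W : Type*} [Field K] [AddCommGroup V] [Module K V]
    [FiniteDimensional K V] [AddCommGroup W] [Module K W] {n : ℕ} (f : V →ₗ[K] W)
    (hn : Module.finrank K V = n) (hf : n ≤ Module.finrank K (LinearMap.range f)) :
    ∃ (e : Module.Basis (Fin n) K V) (φ : Fin n → Module.Dual K W),
      ∀ x j, φ j (f x) = e.repr x j := by
  have hadd := LinearMap.finrank_range_add_finrank_ker f
  obtain ⟨g, hg⟩ := f.exists_leftInverse_of_injective (Submodule.finrank_eq_zero.1 (by omega))
  let e := Module.finBasisOfFinrankEq K V hn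
  exact ⟨e, fun j => e.coord j ∘ₗ g, fun x j => congrArg (e.coord j) (LinearMap.congr_fun hg x)⟩

section CharMatrix

variable {K : Type*} [Field K] {N k n : ℕ} {B : Set (Gr K N k)} {L : Gr K N k}

/-- The matrix of linear forms on `Λ` which describes the characteristic map restricted to the
tangent vectors `η` and composed with the functionals `φ`. -/
def charMatrix {ι κ : Type*} (b : Module.Basis (Fin (k + 1)) K L.toSub)
    (η : ι → tangentSpaceGr B L) (φ : κ → Module.Dual K (Vec K N ⧸ L.toSub)) :
    Matrix ι κ (MvPolynomial (Fin (k + 1)) K) :=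
  of fun i j => charEntry L b (η i).1 (φ j)

theorem eval_charEntry (b : Module.Basis (Fin (k + 1)) K L.toSub)
    (η : L.toSub →ₗ[K] (Vec K N ⧸ L.toSub)) (φ : Module.Dual K (Vec K N ⧸ L.toSub))
    (v : L.toSub) : eval (b.equivFun v) (charEntry L b η φ) = φ (η v) := by
  conv_rhs => rw [← b.sum_equivFun v, map_sum, map_sum]
  rw [charEntry, map_sum]
  exact Finset.sum_congr rfl fun l _ => by
    rw [map_mul, eval_C, eval_X, map_smul, map_smul, smul_eq_mul, mul_comm]

theorem eval_charMatrix {ι κ : Type*} (b : Module.Basis (Fin (k + 1)) K L.toSub)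
    (η : ι → tangentSpaceGr B L) (φ : κ → Module.Dual K (Vec K N ⧸ L.toSub)) (v : L.toSub) :
    (charMatrix b η φ).map (eval (b.equivFun v)) =
      of fun i j => φ j (characteristicMap B L v (η i)) :=
  Matrix.ext fun i j => eval_charEntry b (η i).1 (φ j) v

theorem eval_det_charMatrix {ι : Type*} [Fintype ι] [DecidableEq ι]
    (b : Module.Basis (Fin (k + 1)) K L.toSub) (η : ι → tangentSpaceGr B L)
    (φ : ι → Module.Dual K (Vec K N ⧸ L.toSub)) (v : L.toSub) :
    eval (b.equivFun v) (charMatrix b η φ).det =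
      (of fun i j => φ j (characteristicMap B L v (η i)) : Matrix ι ι K).det := by
  rw [RingHom.map_det, RingHom.mapMatrix_apply, eval_charMatrix]

theorem linearIndependent_of_eval_det_charMatrix_ne_zero {ι : Type*} [Fintype ι] [DecidableEq ι]
    {b : Module.Basis (Fin (k + 1)) K L.toSub} {η : ι → tangentSpaceGr B L}
    {φ : ι → Module.Dual K (Vec K N ⧸ L.toSub)} {v : L.toSub}
    (hdet : eval (b.equivFun v) (charMatrix b η φ).det ≠ 0) :
    LinearIndependent K fun i => characteristicMap B L v (η i) := by
  rw [eval_det_charMatrix] at hdet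
  refine LinearIndependent.of_comp (LinearMap.pi φ) ?_
  exact linearIndependent_rows_of_isUnit ((isUnit_iff_isUnit_det _).2 hdet.isUnit)

/-- The functionals `φ` on the normal space are dual to the basis `η` of the tangent space, via the
characteristic map at `v`. -/
def IsDualAt {ι : Type*} (v : L.toSub) (η : Module.Basis ι K (tangentSpaceGr B L))
    (φ : ι → Module.Dual K (Vec K N ⧸ L.toSub)) : Prop :=
  ∀ ξ j, φ j (characteristicMap B L v ξ) = η.repr ξ j

section IsDualAt

variable {ι : Type*} [Fintype ι] {v₀ : L.toSub} {η : Module.Basis ι K (tangentSpaceGr B L)}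
  {φ : ι → Module.Dual K (Vec K N ⧸ L.toSub)}

theorem IsDualAt.eval_det_charMatrix_eq_one [DecidableEq ι] (h : IsDualAt v₀ η φ)
    (b : Module.Basis (Fin (k + 1)) K L.toSub) :
    eval (b.equivFun v₀) (charMatrix b η φ).det = 1 := by
  rw [eval_det_charMatrix, ← det_one (n := ι)]
  congr 1
  ext i j
  rw [of_apply, h, η.repr_self, Finsupp.single_apply, one_apply]

theorem IsDualAt.det_charMatrix_ne_zero [DecidableEq ι] (h : IsDualAt v₀ η φ)
    (b : Module.Basis (Fin (k + 1)) K L.toSub) : (charMatrix b η φ).det ≠ 0 := fun h0 =>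
  zero_ne_one (by rw [← h.eval_det_charMatrix_eq_one b, h0, map_zero])

end IsDualAt

namespace IsRuledFamily

variable (h : IsRuledFamily B n)
include h

theorem not_isFocalAt_of_linearIndependent (hL : IsSmoothMember B L) {v : L.toSub}
    {η : Fin n → tangentSpaceGr B L}
    (hli : LinearIndependent K fun i => characteristicMap B L v (η i)) : ¬ IsFocalAt B L v := by
  rw [IsFocalAt, h.maxRank_eq hL, not_lt]
  simpa only [Fintype.card_fin] using
    card_le_finrank_of_forall_mem hli fun i => LinearMap.mem_range_self _ (η i)

theorem exists_isDualAt (hL : IsSmoothMember B L) {v : L.toSub} (hv : ¬ IsFocalAt B L v) :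
    ∃ (η : Module.Basis (Fin n) K (tangentSpaceGr B L))
      (φ : Fin n → Module.Dual K (Vec K N ⧸ L.toSub)), IsDualAt v η φ := by
  have hrank := (h.not_isFocalAt_iff hL v).1 hv
  rw [finrank_tangentHull] at hrank
  exact exists_basis_dual_repr_eq (V := tangentSpaceGr B L) (W := Vec K N ⧸ L.toSub)
    (characteristicMap B L v) (h.isSmoothMember_iff.1 hL).2 (by omega)

theorem tangentHull_eq_of_range_le (hL : IsSmoothMember B L) {v v₀ : L.toSub}
    (hv : ¬ IsFocalAt B L v) (hv₀ : ¬ IsFocalAt B L v₀)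
    (hle : LinearMap.range (characteristicMap B L v) ≤ LinearMap.range (characteristicMap B L v₀)) :
    tangentHull B L v = tangentHull B L v₀ :=
  Submodule.eq_of_le_of_finrank_eq (Submodule.comap_mono hle)
    (by rw [(h.not_isFocalAt_iff hL v).1 hv, (h.not_isFocalAt_iff hL v₀).1 hv₀])

variable [CharZero K]

-- At the general point of `Λ` the constant tangent space contains the hull of `Λ` by
-- `tangentHull_le`; as it is a linear space, it contains the hulls at all other points as well.
theorem exists_rowComb_mem_of_tangentConstantAlong (hL : L ∈ B)
    (hT : TangentConstantAlong (unionOf B) L) : ∃ T : Submodule K (Vec K N),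
      Module.finrank K T = n + k + 1 ∧ ∀ b : Module.Basis (Fin (k + 1)) K L.toSub,
        ∀ w ∈ tangentSpace (frames B) (basisFrame b), ∀ t, rowComb t w ∈ T := by
  obtain ⟨⟨x, hxL, hx⟩, T, hT⟩ := hT
  have hTx := hT x hxL hx
  induction x using Projectivization.ind with | h v hv
  rw [Projectivization.submodule_mk, Submodule.span_singleton_le_iff_mem] at hxL
  rw [embeddedTangentSpace_mk] at hTx
  obtain ⟨-, hfin⟩ := (h.isSmoothPoint_mk_iff v hv).1 hx
  obtain ⟨q, hq, hqfin⟩ := h.exists_eval_ne_zero_of_smooth hfin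
  refine ⟨T, hTx ▸ hfin, fun b w hw => ?_⟩
  let Q : MvPolynomial (Fin (k + 1)) K := bind₁ (linearPoly (rowComb.flip (basisFrame b))) q
  have hQ (u : L.toSub) : eval (b.equivFun u) Q = eval (u : Vec K N) q := by
    rw [eval_bind₁_linearPoly, LinearMap.flip_apply, rowComb_equivFun_basisFrame]
  have hQ0 : Q ≠ 0 := fun h0 => hq (by rw [← hQ ⟨v, hxL⟩, h0, map_zero])
  have htop : T.comap (rowComb.flip w) = ⊤ := by
    refine submodule_eq_top_of_eval_ne_zero hQ0 fun t ht => ?_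
    obtain ⟨u, rfl⟩ := b.equivFun.surjective t
    rcases eq_or_ne u 0 with rfl | hu
    · rw [map_zero]
      exact zero_mem _
    have hu0 : (u : Vec K N) ≠ 0 := fun h0 => hu (Subtype.ext h0)
    have hcone : (u : Vec K N) ∈ cone (unionOf B) := mem_cone_unionOf.2 ⟨hu0, L, hL, u.2⟩
    have huT := hT (Projectivization.mk K _ hu0)
      (by rw [Projectivization.submodule_mk, Submodule.span_singleton_le_iff_mem]; exact u.2)
      ((h.isSmoothPoint_mk_iff _ _).2 ⟨hcone, hqfin _ hcone (hQ u ▸ ht)⟩)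
    rw [embeddedTangentSpace_mk] at huT
    exact huT ▸ tangentHull_le hL hu ((mem_tangentHull_iff hL b hu _).2 ⟨w, hw, rfl⟩)
  exact fun t => (htop ▸ Submodule.mem_top : t ∈ T.comap (rowComb.flip w))

-- Otherwise `n + k + 2` independent directions, one along `v` and the others along `v₀`, would
-- deform to a general member and lie in its constant tangent space.
theorem range_le_of_tangentConstantAlong {U : Set (Gr K N k)} (hU : IsOpen U)
    (hUB : (U ∩ B).Nonempty) (hUT : ∀ L ∈ U ∩ B, TangentConstantAlong (unionOf B) L)
    (hL : IsSmoothMember B L) {v₀ : L.toSub} (hv₀ : v₀ ≠ 0) (hf : ¬ IsFocalAt B L v₀)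
    (v : L.toSub) :
    LinearMap.range (characteristicMap B L v) ≤ LinearMap.range (characteristicMap B L v₀) := by
  rintro _ ⟨η, rfl⟩
  by_contra hη
  let b := Module.finBasisOfFinrankEq K L.toSub L.2
  let e := Module.finBasisOfFinrankEq K (tangentHull B L v₀) ((h.not_isFocalAt_iff hL v₀).1 hf)
  choose w hw hwe using fun a => (mem_tangentHull_iff hL.1 b hv₀ _).1 (e a).2
  obtain ⟨w₁, hw₁, hw₁η⟩ := (mem_tangentSpaceGr_iff b η.1).1 η.2
  have hw₁v : rowComb (b.equivFun v) w₁ ∉ tangentHull B L v₀ := by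
    have hη' : characteristicMap B L v η = frameHom b w₁ v := by rw [hw₁η]; rfl
    rwa [hη'] at hη
  let t : Fin (n + k + 1 + 1) → Fin (k + 1) → K := Fin.cons (b.equivFun v) fun _ => b.equivFun v₀
  let ω : Fin (n + k + 1 + 1) → Fin (k + 1) × Fin (N + 1) → K := Fin.cons w₁ w
  have hω : ∀ a, ω a ∈ tangentSpace (frames B) (basisFrame b) := Fin.cases hw₁ hw
  have hli : LinearIndependent K fun a => rowComb (t a) (ω a) := by
    have heq : (fun a => rowComb (t a) (ω a)) =
        Fin.cons (rowComb (b.equivFun v) w₁) fun a => (e a : Vec K N) :=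
      funext (Fin.cases rfl hwe)
    exact heq ▸ linearIndependent_finCons_basis e hw₁v
  obtain ⟨O, hO, hLO, hnear⟩ := h.exists_isOpen_linearIndependent hL b t ω hω hli
  obtain ⟨L', hL'B, hL'U, hL'O⟩ :=
    h.irreducible.2 U O hU hO (Set.inter_comm U B ▸ hUB) ⟨L, hL.1, hLO⟩
  obtain ⟨-, b', w', hw', hli'⟩ := hnear L' hL'O hL'B
  obtain ⟨T, hT, hmem⟩ :=
    h.exists_rowComb_mem_of_tangentConstantAlong hL'B (hUT L' ⟨hL'U, hL'B⟩)
  have hcard := card_le_finrank_of_forall_mem hli' fun a => hmem b' (w' a) (hw' a) (t a)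
  rw [Fintype.card_fin, hT] at hcard
  omega

theorem tangentHull_le_of_range_le (hL : IsSmoothMember B L) {v₀ : L.toSub}
    (hf : ¬ IsFocalAt B L v₀)
    (hle : ∀ v, LinearMap.range (characteristicMap B L v)
      ≤ LinearMap.range (characteristicMap B L v₀)) (v : L.toSub) :
    tangentHull B L v₀ ≤ tangentSpace (cone (unionOf B)) (v : Vec K N) := by
  intro u hu
  let b := Module.finBasisOfFinrankEq K L.toSub L.2
  obtain ⟨η, φ, hηφ⟩ := h.exists_isDualAt hL hf
  have hΔ : (charMatrix b η φ).det * X 0 ≠ 0 :=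
    mul_ne_zero (hηφ.det_charMatrix_ne_zero b) (X_ne_zero 0)
  rw [← rowComb_equivFun_basisFrame b]
  refine mem_tangentSpace_of_eval_ne_zero (rowComb.flip (basisFrame b)) hΔ (fun t ht => ?_) _
  obtain ⟨v, rfl⟩ := b.equivFun.surjective t
  rw [map_mul, eval_X] at ht
  have hv : v ≠ 0 := by
    rintro rfl
    exact right_ne_zero_of_mul ht (congrFun (map_zero b.equivFun) 0)
  have hvf : ¬ IsFocalAt B L v := h.not_isFocalAt_of_linearIndependent hL
    (linearIndependent_of_eval_det_charMatrix_ne_zero (left_ne_zero_of_mul ht))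
  rw [← h.tangentHull_eq_of_range_le hL hvf hf (hle v)] at hu
  rw [LinearMap.flip_apply, rowComb_equivFun_basisFrame]
  exact tangentHull_le hL.1 hv hu

theorem tangentConstantAlong_of_range_le (hL : IsSmoothMember B L) {v₀ : L.toSub}
    (hf : ¬ IsFocalAt B L v₀)
    (hle : ∀ v, LinearMap.range (characteristicMap B L v)
      ≤ LinearMap.range (characteristicMap B L v₀))
    (hs : ∃ x : PSpace K N, x.submodule ≤ L.toSub ∧ IsSmoothPoint (unionOf B) x) :
    TangentConstantAlong (unionOf B) L := by
  refine ⟨hs, tangentHull B L v₀, fun x hxL hx => ?_⟩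
  induction x using Projectivization.ind with | h v hv
  rw [Projectivization.submodule_mk, Submodule.span_singleton_le_iff_mem] at hxL
  rw [embeddedTangentSpace_mk]
  obtain ⟨-, hfin⟩ := (h.isSmoothPoint_mk_iff v hv).1 hx
  exact (Submodule.eq_of_le_of_finrank_eq (h.tangentHull_le_of_range_le hL hf hle ⟨v, hxL⟩)
    (by rw [hfin, (h.not_isFocalAt_iff hL v₀).1 hf])).symm

end IsRuledFamily

end CharMatrix

/-! ### The focal ideal -/

section Forms

variable {K σ : Type*} [Field K] {F P : MvPolynomial σ K}

theorem dvd_of_irrelevant_pow_mul_mem {i j : σ} (hij : i ≠ j) (hF : F ≠ 0) {m : ℕ}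
    (h : ∀ Q ∈ Ideal.span (Set.range (X (R := K) (σ := σ))) ^ m, Q * P ∈ Ideal.span {F}) :
    F ∣ P := by
  have hX l : F ∣ X l ^ m * P := Ideal.mem_span_singleton.1
    (h _ (Ideal.pow_mem_pow (Ideal.subset_span (Set.mem_range_self l)) m))
  obtain ⟨u, hu⟩ := hX i
  obtain ⟨w, hw⟩ := hX j
  have huw : u * X j ^ m = X i ^ m * w :=
    mul_left_cancel₀ hF (by linear_combination (-X j ^ m) * hu + X i ^ m * hw)
  have hX_ndvd : ¬ (X i : MvPolynomial σ K) ∣ X j ^ m := fun hd =>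
    hij (X_dvd_X.1 (X_prime.dvd_of_dvd_pow hd))
  obtain ⟨u', rfl⟩ := X_prime.pow_dvd_of_dvd_mul_right m hX_ndvd ⟨w, huw⟩
  exact ⟨u', mul_left_cancel₀ (pow_ne_zero m (X_ne_zero i)) (hu.trans (mul_left_comm _ _ _))⟩

theorem exists_eq_C_mul_of_dvd {n : ℕ} (hF : F.IsHomogeneous n) (hP : P.IsHomogeneous n)
    (h : F ∣ P) : ∃ c, P = C c * F := by
  obtain ⟨q, rfl⟩ := h
  rcases eq_or_ne (F * q) 0 with h0 | h0
  · exact ⟨0, by rw [h0, map_zero, zero_mul]⟩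
  · have hdeg := totalDegree_mul_of_isDomain (left_ne_zero_of_mul h0) (right_ne_zero_of_mul h0)
    rw [hP.totalDegree h0, hF.totalDegree (left_ne_zero_of_mul h0)] at hdeg
    refine ⟨q.coeff 0, ?_⟩
    rw [mul_comm, ← totalDegree_eq_zero_iff_eq_C.1 (by omega : q.totalDegree = 0)]

end Forms

theorem isHomogeneous_det {R σ ι : Type*} [CommRing R] [Fintype ι] [DecidableEq ι]
    (A : Matrix ι ι (MvPolynomial σ R)) {d : ℕ} (hA : ∀ i j, (A i j).IsHomogeneous d) :
    A.det.IsHomogeneous (Fintype.card ι * d) := by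
  rw [det_apply]
  refine IsHomogeneous.sum _ _ _ fun s _ => ?_
  have hprod : (∏ i, A (s i) i).IsHomogeneous (∑ _i : ι, d) :=
    IsHomogeneous.prod _ _ _ fun i _ => hA _ _
  rw [Finset.sum_const, smul_eq_mul, Finset.card_univ] at hprod
  rcases Int.units_eq_one_or (Equiv.Perm.sign s) with hs | hs
  · rwa [hs, one_smul]
  · rw [hs, Units.neg_smul, one_smul]
    exact hprod.neg

theorem eq_zero_of_forall_det_updateCol_eq_zero {R ι : Type*} [CommRing R] [IsDomain R] [Fintype ι]
    [DecidableEq ι] {A : Matrix ι ι R} (hA : A.det ≠ 0) {x : ι → R}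
    (hx : ∀ j, (A.updateCol j x).det = 0) : x = 0 := by
  have hcramer : cramer A x = 0 := funext fun j => (cramer_apply A x j).trans (hx j)
  have hsmul := mulVec_cramer A x
  rw [hcramer, mulVec_zero, eq_comm] at hsmul
  exact (smul_eq_zero.1 hsmul).resolve_left hA

section FocalIdeal

variable {K : Type*} [Field K] {N k n : ℕ} {B : Set (Gr K N k)} {L : Gr K N k}

theorem isHomogeneous_det_charMatrix (b : Module.Basis (Fin (k + 1)) K L.toSub)
    (η : Fin n → tangentSpaceGr B L) (φ : Fin n → Module.Dual K (Vec K N ⧸ L.toSub)) :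
    (charMatrix b η φ).det.IsHomogeneous n := by
  have hentry i j : (charMatrix b η φ i j).IsHomogeneous 1 := by
    rw [charMatrix, of_apply, charEntry]
    exact IsHomogeneous.sum _ _ _ fun _ _ => isHomogeneous_C_mul_X _ _
  have hdet := isHomogeneous_det (charMatrix b η φ) hentry
  rwa [Fintype.card_fin, mul_one] at hdet

theorem charMatrix_update {ι κ : Type*} [DecidableEq κ] (b : Module.Basis (Fin (k + 1)) K L.toSub)
    (η : ι → tangentSpaceGr B L) (φ : κ → Module.Dual K (Vec K N ⧸ L.toSub)) (j : κ)
    (ψ : Module.Dual K (Vec K N ⧸ L.toSub)) : charMatrix b η (Function.update φ j ψ) =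
      (charMatrix b η φ).updateCol j fun i => charEntry L b (η i).1 ψ := by
  ext1 i l
  rcases eq_or_ne l j with rfl | hl
  · rw [updateCol_self, charMatrix, of_apply, Function.update_self]
  · rw [updateCol_ne hl, charMatrix, charMatrix, of_apply, of_apply, Function.update_of_ne hl]

section IsDualAt

variable {ι κ : Type*} [Fintype ι] {v₀ : L.toSub} {η : Module.Basis ι K (tangentSpaceGr B L)}
  {φ : ι → Module.Dual K (Vec K N ⧸ L.toSub)}

theorem IsDualAt.sum_smul_eq (h : IsDualAt v₀ η φ) {z : Vec K N ⧸ L.toSub}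
    (hz : z ∈ LinearMap.range (characteristicMap B L v₀)) :
    ∑ m, φ m z • characteristicMap B L v₀ (η m) = z := by
  obtain ⟨ξ, rfl⟩ := hz
  simp_rw [h ξ _, ← map_smul, ← map_sum, η.sum_repr]

theorem IsDualAt.exists_charMatrix_eq [Infinite K] (h : IsDualAt v₀ η φ)
    (hle : ∀ v, LinearMap.range (characteristicMap B L v)
      ≤ LinearMap.range (characteristicMap B L v₀))
    (b : Module.Basis (Fin (k + 1)) K L.toSub) (η' : κ → tangentSpaceGr B L)
    (φ' : κ → Module.Dual K (Vec K N ⧸ L.toSub)) :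
    ∃ (S : Matrix κ ι (MvPolynomial (Fin (k + 1)) K))
      (D : Matrix ι κ (MvPolynomial (Fin (k + 1)) K)),
      charMatrix b η' φ' = S * charMatrix b η φ * D := by
  refine ⟨of fun i l => C (η.repr (η' i) l),
    of fun m j => C (φ' j (characteristicMap B L v₀ (η m))),
    Matrix.ext fun i j => MvPolynomial.funext fun t => ?_⟩
  obtain ⟨v, rfl⟩ := b.equivFun.surjective t
  have hη' : characteristicMap B L v (η' i) =
      ∑ l, η.repr (η' i) l • characteristicMap B L v (η l) := by
    simp_rw [← map_smul, ← map_sum, η.sum_repr]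
  have hφ' : φ' j (characteristicMap B L v (η' i)) =
      ∑ m, φ m (characteristicMap B L v (η' i)) * φ' j (characteristicMap B L v₀ (η m)) := by
    conv_lhs => rw [← h.sum_smul_eq (hle v (LinearMap.mem_range_self _ _)), map_sum]
    exact Finset.sum_congr rfl fun m _ => map_smul _ _ _
  refine (eval_charEntry b (η' i).1 (φ' j) v).trans (hφ'.trans ?_)
  rw [mul_apply, map_sum]
  refine Finset.sum_congr rfl fun m _ => ?_
  rw [map_mul, of_apply, eval_C, mul_apply, map_sum, hη', map_sum]
  congr 1
  refine Finset.sum_congr rfl fun l _ => ?_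
  rw [map_mul, of_apply, eval_C, map_smul, smul_eq_mul]
  exact congrArg _ (eval_charEntry b (η l).1 (φ m) v).symm

end IsDualAt

namespace IsRuledFamily

variable (h : IsRuledFamily B n)
include h

theorem focalIdeal_eq (hL : IsSmoothMember B L) (b : Module.Basis (Fin (k + 1)) K L.toSub) :
    focalIdeal B L b = Ideal.span {P | ∃ (η : Fin n → tangentSpaceGr B L)
      (φ : Fin n → Module.Dual K (Vec K N ⧸ L.toSub)), P = (charMatrix b η φ).det} := by
  rw [focalIdeal, h.maxRank_eq hL]
  rfl

-- The factorization makes every minor of maximal order a multiple of the one at a dual pair.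
theorem focalHypersurface_of_range_le [Infinite K] (hL : IsSmoothMember B L) {v₀ : L.toSub}
    (hf : ¬ IsFocalAt B L v₀)
    (hle : ∀ v, LinearMap.range (characteristicMap B L v)
      ≤ LinearMap.range (characteristicMap B L v₀)) :
    FocalHypersurface B L n := by
  intro b
  obtain ⟨η, φ, hηφ⟩ := h.exists_isDualAt hL hf
  have hideal : focalIdeal B L b = Ideal.span {(charMatrix b η φ).det} := by
    rw [h.focalIdeal_eq hL]
    refine le_antisymm (Ideal.span_le.2 ?_) (Ideal.span_mono ?_)
    · rintro _ ⟨η', φ', rfl⟩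
      obtain ⟨S, D, hSD⟩ := hηφ.exists_charMatrix_eq hle b η' φ'
      rw [hSD, det_mul, det_mul]
      exact Ideal.mul_mem_right _ _ (Ideal.mul_mem_left _ _ (Ideal.mem_span_singleton_self _))
    · exact Set.singleton_subset_iff.2 ⟨η, φ, rfl⟩
  exact ⟨_, hηφ.det_charMatrix_ne_zero b, isHomogeneous_det_charMatrix b η φ,
    hideal ▸ fun _ => Iff.rfl⟩

theorem exists_det_charMatrix_eq (hk : 0 < k) (hL : IsSmoothMember B L)
    {b : Module.Basis (Fin (k + 1)) K L.toSub} {F : MvPolynomial (Fin (k + 1)) K} (hF0 : F ≠ 0)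
    (hFn : F.IsHomogeneous n) (hF : SameSubscheme (focalIdeal B L b) (Ideal.span {F}))
    (η : Fin n → tangentSpaceGr B L) (φ : Fin n → Module.Dual K (Vec K N ⧸ L.toSub)) :
    ∃ c, (charMatrix b η φ).det = C c * F := by
  rw [h.focalIdeal_eq hL] at hF
  obtain ⟨m, hm⟩ := (hF _).1
    ⟨0, fun Q _ => Ideal.mul_mem_left _ Q (Ideal.subset_span ⟨η, φ, rfl⟩)⟩
  have hne : (0 : Fin (k + 1)) ≠ Fin.last k := Fin.ne_of_val_ne hk.ne
  exact exists_eq_C_mul_of_dvd hFn (isHomogeneous_det_charMatrix b η φ)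
    (dvd_of_irrelevant_pow_mul_mem hne hF0 hm)

theorem det_charMatrix_update_eq_zero (hk : 0 < k) (hL : IsSmoothMember B L)
    (hH : FocalHypersurface B L n) {v₀ : L.toSub} {η : Module.Basis (Fin n) K (tangentSpaceGr B L)}
    {φ : Fin n → Module.Dual K (Vec K N ⧸ L.toSub)} (hηφ : IsDualAt v₀ η φ)
    (b : Module.Basis (Fin (k + 1)) K L.toSub) {ψ : Module.Dual K (Vec K N ⧸ L.toSub)}
    (hψ : LinearMap.range (characteristicMap B L v₀) ≤ LinearMap.ker ψ) (j : Fin n) :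
    (charMatrix b η (Function.update φ j ψ)).det = 0 := by
  obtain ⟨F, hF0, hFn, hF⟩ := hH b
  obtain ⟨c₀, hc₀⟩ := h.exists_det_charMatrix_eq hk hL hF0 hFn hF η φ
  obtain ⟨c, hc⟩ := h.exists_det_charMatrix_eq hk hL hF0 hFn hF η (Function.update φ j ψ)
  have hF_eval : eval (b.equivFun v₀) F ≠ 0 := fun h0 => zero_ne_one (by
    rw [← hηφ.eval_det_charMatrix_eq_one b, hc₀, map_mul, h0, mul_zero])
  have hzero : eval (b.equivFun v₀) (charMatrix b η (Function.update φ j ψ)).det = 0 := by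
    rw [eval_det_charMatrix]
    refine det_eq_zero_of_column_eq_zero j fun i => ?_
    rw [of_apply, Function.update_self]
    exact hψ (LinearMap.mem_range_self _ _)
  rw [hc, map_mul, eval_C] at hzero
  rw [hc, (mul_eq_zero.1 hzero).resolve_right hF_eval, map_zero, zero_mul]

-- If `ψ` vanishes on the image at `v₀`, then by Cramer's rule over the polynomial ring its column
-- is a combination of the columns of the `φ j` with quotients of vanishing minors as coefficients.
theorem range_le_of_focalHypersurface (hk : 0 < k) (hL : IsSmoothMember B L) {v₀ : L.toSub}
    (hf : ¬ IsFocalAt B L v₀) (hH : FocalHypersurface B L n) (v : L.toSub) :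
    LinearMap.range (characteristicMap B L v) ≤ LinearMap.range (characteristicMap B L v₀) := by
  let b := Module.finBasisOfFinrankEq K L.toSub L.2
  obtain ⟨η, φ, hηφ⟩ := h.exists_isDualAt hL hf
  rintro _ ⟨ξ, rfl⟩
  by_contra hξ
  obtain ⟨ψ, hψξ, hψ⟩ := Submodule.exists_le_ker_of_notMem hξ
  have hcol : (fun i => charEntry L b (η i).1 ψ) = 0 :=
    eq_zero_of_forall_det_updateCol_eq_zero (hηφ.det_charMatrix_ne_zero b) fun j =>
      charMatrix_update b η φ j ψ ▸ h.det_charMatrix_update_eq_zero hk hL hH hηφ b hψ j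
  have hzero : ψ ∘ₗ characteristicMap B L v = 0 := η.ext fun i => by
    have heval := eval_charEntry b (η i).1 ψ v
    rw [congrFun hcol i] at heval
    exact heval.symm.trans (map_zero _)
  exact hψξ (LinearMap.congr_fun hzero ξ)

end IsRuledFamily

end FocalIdeal

theorem isRuledFamily {K : Type*} [Field K] [IsAlgClosed K] [CharZero K] {N k n : ℕ}
    {B : Set (Gr K N k)} (hBclosed : IsClosed B) (hBirr : IsIrreducible B)
    (hBdim : topologicalKrullDim B = (n : WithBot ℕ∞))
    (hXclosed : IsClosed (unionOf B)) (hXirr : IsIrreducible (unionOf B))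
    (hXdim : topologicalKrullDim (unionOf B) = ((n + k : ℕ) : WithBot ℕ∞))
    (hN : n + k < N) : IsRuledFamily B n where
  dim_eq := hBdim
  dim_union := hXdim
  irreducible := hBirr
  hasDim_frames := RuledVariety.hasDim_frames hBclosed hBirr hBdim
  hasDim_cone := RuledVariety.hasDim_cone hXclosed hXirr hXdim
  lt := hN

section Equivalence

variable {K : Type*} [Field K] {N k n : ℕ}

theorem submodule_eq_of_le {L : Gr K N 0} {x : PSpace K N} (hx : x.submodule ≤ L.toSub) :
    x.submodule = L.toSub :=
  Submodule.eq_of_le_of_finrank_eq hx (x.finrank_submodule.trans L.2.symm)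

theorem tangentConstantAlong_of_exists_isSmoothPoint {X : Set (PSpace K N)} {L : Gr K N 0}
    (hs : ∃ x : PSpace K N, x.submodule ≤ L.toSub ∧ IsSmoothPoint X x) :
    TangentConstantAlong X L := by
  obtain ⟨x, hx, hxs⟩ := hs
  refine ⟨⟨x, hx, hxs⟩, embeddedTangentSpace X x, fun y hy _ => ?_⟩
  rw [Projectivization.submodule_injective
    ((submodule_eq_of_le hy).trans (submodule_eq_of_le hx).symm)]

variable {B : Set (Gr K N k)} {L : Gr K N k}

namespace IsRuledFamily

variable [CharZero K] (h : IsRuledFamily B n)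
include h

theorem focalHypersurface_of_tangentConstantAlong {U : Set (Gr K N k)} (hU : IsOpen U)
    (hUB : (U ∩ B).Nonempty) (hUT : ∀ L ∈ U ∩ B, TangentConstantAlong (unionOf B) L)
    (hL : IsSmoothMember B L) (hf : ¬ AllFocal B L) : FocalHypersurface B L n := by
  obtain ⟨v, hv, hvf⟩ := not_allFocal_iff.1 hf
  exact h.focalHypersurface_of_range_le hL hvf
    (h.range_le_of_tangentConstantAlong hU hUB hUT hL hv hvf)

theorem tangentConstantAlong_of_focalHypersurface (hL : IsSmoothMember B L) (hf : ¬ AllFocal B L)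
    (hH : FocalHypersurface B L n)
    (hs : ∃ x : PSpace K N, x.submodule ≤ L.toSub ∧ IsSmoothPoint (unionOf B) x) :
    TangentConstantAlong (unionOf B) L := by
  rcases Nat.eq_zero_or_pos k with rfl | hk
  · exact tangentConstantAlong_of_exists_isSmoothPoint hs
  · obtain ⟨v, -, hvf⟩ := not_allFocal_iff.1 hf
    exact h.tangentConstantAlong_of_range_le hL hvf
      (h.range_le_of_focalHypersurface hk hL hvf hH) hs

theorem exists_isOpen_tangentConstantAlong {U : Set (Gr K N k)} (hU : IsOpen U)
    (hUB : ∃ L ∈ U, IsSmoothMember B L)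
    (hUF : ∀ L ∈ U, IsSmoothMember B L → FocalHypersurface B L n) :
    ∃ U : Set (Gr K N k), IsOpen U ∧ (U ∩ B).Nonempty ∧
      ∀ L ∈ U ∩ B, TangentConstantAlong (unionOf B) L := by
  obtain ⟨L₀, hL₀, hf₀⟩ := h.exists_not_allFocal
  obtain ⟨O, hO, hL₀O, hOB⟩ := h.exists_isOpen_not_allFocal hL₀ hf₀
  obtain ⟨S, hS, hSB, hSs⟩ := h.exists_isOpen_exists_smooth
  obtain ⟨L₁, hL₁U, hL₁⟩ := hUB
  have hmeet : (B ∩ (U ∩ (O ∩ S))).Nonempty :=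
    h.irreducible.2 U (O ∩ S) hU (hO.inter hS) ⟨L₁, hL₁.1, hL₁U⟩
      (h.irreducible.2 O S hO hS ⟨L₀, hL₀.1, hL₀O⟩ hSB)
  refine ⟨U ∩ (O ∩ S), hU.inter (hO.inter hS), Set.inter_comm B _ ▸ hmeet, ?_⟩
  rintro L ⟨⟨hLU, hLO, hLS⟩, hLB⟩
  obtain ⟨hL, hf⟩ := hOB L hLO hLB
  exact h.tangentConstantAlong_of_focalHypersurface hL hf (hUF L hLU hL) (hSs L hLS hLB)

end IsRuledFamily

end Equivalence

end RuledVariety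

end

open RuledVariety in
theorem theorem0p2 {K : Type*} [Field K] [IsAlgClosed K] [CharZero K] (N k n : ℕ)
    (B : Set (Gr K N k)) (hBclosed : IsClosed B) (hBirr : IsIrreducible B)
    (hBdim : topologicalKrullDim B = (n : WithBot ℕ∞))
    (hXclosed : IsClosed (unionOf B)) (hXirr : IsIrreducible (unionOf B))
    (hXdim : topologicalKrullDim (unionOf B) = ((n + k : ℕ) : WithBot ℕ∞))
    (hN : n + k < N) :
    (∃ U : Set (Gr K N k), IsOpen U ∧ (U ∩ B).Nonempty ∧
      ∀ L ∈ U ∩ B, TangentConstantAlong (unionOf B) L) ↔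
    (∃ U : Set (Gr K N k), IsOpen U ∧ (∃ L ∈ U, IsSmoothMember B L) ∧
      ∀ L, IsSmoothMember B L →
        (L ∈ U → FocalHypersurface B L n) ∧ (L ∉ U → AllFocal B L)) := by
  have h := isRuledFamily hBclosed hBirr hBdim hXclosed hXirr hXdim hN
  constructor
  · rintro ⟨U, hU, hUB, hUT⟩
    let U' := interior {L | L ∈ B → IsSmoothMember B L ∧ ¬ AllFocal B L}
    have hU' {L : Gr K N k} (hL : IsSmoothMember B L) (hf : ¬ AllFocal B L) : L ∈ U' := by
      obtain ⟨O, hO, hLO, hOB⟩ := h.exists_isOpen_not_allFocal hL hf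
      exact mem_interior.2 ⟨O, hOB, hO, hLO⟩
    obtain ⟨L₀, hL₀, hf₀⟩ := h.exists_not_allFocal
    refine ⟨U', isOpen_interior, ⟨L₀, hU' hL₀ hf₀, hL₀⟩, fun L hL => ⟨fun hLU => ?_, ?_⟩⟩
    · exact h.focalHypersurface_of_tangentConstantAlong hU hUB hUT hL
        (interior_subset hLU hL.1).2
    · exact fun hLU => by_contra fun hf => hLU (hU' hL hf)
  · rintro ⟨U, hU, hUB, hUF⟩
    exact h.exists_isOpen_tangentConstantAlong hU hUB fun L hLU hL => (hUF L hL).1 hLU
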